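/- **Setting.** Two subnetworks $\Xi_1,\Xi_2$ have $n_1,n_2\ge 1$ agents. Let $X\subseteq\mathbb R^{m_1}$, $Y\subseteq\mathbb R^{m_2}$ be closed and convex. Agent $i$ of $\Xi_1$ has a function $f_i$ and agent $i$ of $\Xi_2$ a function $g_i$, all from $\mathbb R^{m_1}\times\mathbb R^{m_2}$ to $\mathbb R$, convex in the first and concave in the second argument, with $U=\sum_i f_i=\sum_i g_i$ on $X\times Y$. At each time $k=0,1,\dots$ there are nonnegative weights $a_{ij}(k)$ between agents; the arc $(j,i)$ is present at time $k$ iff $a_{ij}(k)>0$, and $a_{ii}(k)>0$ always. $A_\ell(k)$ is the matrix of the weights within $\Xi_\ell$, and $\mathcal N_i^\ell(k)$ is the set of the $j$ in $\Xi_\ell$ with $a_{ij}(k)>0$. Assume: * **A1.** For each stochastic vector $\mu$, $\sum_i\mu_if_i$ has a saddle point on $X\times Y$. * **A2.** For some $T>0$, in every time window of length $T$ each agent has at least once a neighbour in the other subnetwork; and for $\ell=1,2$ there is $T_\ell>0$ such that the union of the graphs of $A_\ell(s)$, $k\le s<k+T_\ell$, is strongly connected for every $k$. * **A3.** There is $\eta\in(0,1)$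 such that all positive weights are at least $\eta$; for each agent and time the weights of the neighbours in its own subnetwork sum to $1$; so do the weights of the neighbours in the other subnetwork whenever there is such a neighbour. * **A4.** There is $L>0$ with $|q|\le L$ for all $q\in\partial_xf_i(x,y)\cup\partial_yg_j(x,y)$, all $i,j$ and all $(x,y)\in X\times Y$. * $U$ is strictly convex-concave on $X\times Y$. * $\gamma_k$ is non-increasing, $\gamma_k\sum_{s<k}\gamma_s\to0$, $\sum_k\gamma_k=\infty$, $\sum_k\gamma_k^2<\infty$. **Algorithm.** With stepsizes $\alpha_{i,k},\beta_{i,k}>0$, from arbitrary initial states, $$x_i(k+1)=P_X\big(\hat x_i(k)-\alpha_{i,k}q_{1i}(k)\big),\quad q_{1i}(k)\in\partial_xf_i(\hat x_i(k),\breve x_i(k)),$$ $$y_i(k+1)=P_Y\big(\hat y_i(k)+\beta_{i,k}q_{2i}(k)\big),\quad q_{2i}(k)\in\partial_yg_i(\breve y_i(k),\hat y_i(k)),$$ where $\hat x_i(k)=\sum_{j\in\mathcal N^1_i(k)}a_{ij}(k)x_j(k)$, $\hat y_i(k)=\sum_{j\in\mathcal N^2_i(k)}a_{ij}(k)y_j(k)$,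 and $\breve x_i(k)=\sum_{j\in\mathcal N^2_i(\breve k_i)}a_{ij}(\breve k_i)y_j(\breve k_i)$, $\breve y_i(k)=\sum_{j\in\mathcal N^1_i(\breve k_i)}a_{ij}(\breve k_i)x_j(\breve k_i)$, with $\breve k_i\le k$ the last time up to $k$ at which agent $i$ had a neighbour in the other subnetwork ($\breve x_i(k)$, $\breve y_i(k)$ are arbitrary if there was none). The network *achieves a Nash equilibrium* if, for all initial states and all choices of subgradients, there is a saddle point $(x^*,y^*)$ of $U$ on $X\times Y$ with $x_i(k)\to x^*$ and $y_j(k)\to y^*$ for all agents $i$ of $\Xi_1$ and $j$ of $\Xi_2$. **Estimators.** The stepsizes are $\alpha_{i,k}=\gamma_k/\hat\alpha^i_k$, $\beta_{i,k}=\gamma_k/\hat\beta^i_k$. Call a rule that computes $\hat\alpha^i_k$ from the weights in $\Xi_1$ *distributed* if $\hat\alpha^i_k$ depends only on the information that agent $i$ has gathered up to time $k$, where at each time $s$ an agent learns the weights $a_{ij}(s)$, $j\in\mathcal N^1_i(s)$, and receives from these neighbours what they had gathered before time $s$. Say that positive estimates *learn the Perron entries* if, for each $s$, $\lim_{r\to\infty}A_1(r)\cdots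 A_1(s)=\mathbf 1\phi^1(s)'$ for some vector $\phi^1(s)$, and $\hat\alpha^i_k-\phi^1_i(k+1)\to0$ as $k\to\infty$ for each $i$. The same is defined for $\hat\beta^i_k$ with $\Xi_2$, $A_2$, $\phi^2$. For a start time $t$ let $\alpha^{[t]i}(t)$ be the $i$-th unit vector and $\alpha^{[t]i}(s+1)=\sum_{j\in\mathcal N^1_i(s)}a_{ij}(s)\alpha^{[t]j}(s)$ for $s\ge t$ (for $s<t$, $\alpha^{[t]i}(s)$ is the $i$-th unit vector by convention); $\beta^{[t]i}$ is defined alike in $\Xi_2$. **Theorem.** (i) Suppose that, for $\ell=1,2$, the matrices $A_\ell(k)$, $k\ge0$, have a common left eigenvector with eigenvalue one. Then the estimates $\hat\alpha^i_k=\alpha^{[0]i}_i(k)$, $\hat\beta^i_k=\beta^{[0]i}_i(k)$ are distributed, positive and learn the Perron entries, and with them the network achieves a Nash equilibrium. (ii) Suppose that, for $\ell=1,2$, there are $p^\ell\geq 1$ and stochastic matrices $A^0_\ell,\dots,A_\ell^{p^\ell-1}$ with $A_\ell(rp^\ell+s)=A_\ell^s$ for all $r\ge0$, $0\le s<p^\ell$.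 Then the estimates $\hat\alpha^i_{rp^1+\nu}=\alpha^{[\nu+1]i}_i(rp^1+\nu)$, $0\le\nu<p^1$, and $\hat\beta^i_{rp^2+\nu}=\beta^{[\nu+1]i}_i(rp^2+\nu)$, $0\le\nu<p^2$, are distributed (given $p^1,p^2$), positive and learn the Perron entries, and with them the network achieves a Nash equilibrium. Moreover, in each of these two cases the network achieves a Nash equilibrium with any distributed positive estimates that learn the Perron entries. -/

import Mathlib

open Filter Topology

noncomputable section

/-- `ℝ^m` with the Euclidean norm. -/
abbrev Euc (m : ℕ) : Type := EuclideanSpace ℝ (Fin m)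

/-! ### Convex analysis -/

/-- `φ(x, y)` is convex in `x` and concave in `y`, on the whole space. -/
def ConvexConcave {m₁ m₂ : ℕ} (φ : Euc m₁ → Euc m₂ → ℝ) : Prop :=
  (∀ y, ConvexOn ℝ Set.univ (fun x => φ x y)) ∧ (∀ x, ConcaveOn ℝ Set.univ (fun y => φ x y))

/-- `φ(x, y)` is strictly convex in `x ∈ X` for each `y ∈ Y` and strictly concave in `y ∈ Y` for
each `x ∈ X`. -/
def StrictConvexConcaveOn {m₁ m₂ : ℕ} (X : Set (Euc m₁)) (Y : Set (Euc m₂))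
    (φ : Euc m₁ → Euc m₂ → ℝ) : Prop :=
  (∀ y ∈ Y, StrictConvexOn ℝ X (fun x => φ x y)) ∧
    (∀ x ∈ X, StrictConcaveOn ℝ Y (fun y => φ x y))

/-- The subdifferential of a convex function. -/
def convexSubdiff {m : ℕ} (φ : Euc m → ℝ) (z : Euc m) : Set (Euc m) :=
  {v | ∀ w, φ z + inner ℝ (w - z) v ≤ φ w}

/-- The subdifferential of a concave function. -/
def concaveSubdiff {m : ℕ} (φ : Euc m → ℝ) (z : Euc m) : Set (Euc m) :=
  {v | ∀ w, φ w ≤ φ z + inner ℝ (w - z) v}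

/-- `p` is the projection of `z` onto `K`, the nearest point of `K`. -/
def IsProjection {m : ℕ} (K : Set (Euc m)) (z p : Euc m) : Prop :=
  p ∈ K ∧ ∀ w ∈ K, ‖z - p‖ ≤ ‖z - w‖

/-- `(xs, ys)` is a saddle point of `φ` on `X × Y`. -/
def IsSaddlePoint {m₁ m₂ : ℕ} (X : Set (Euc m₁)) (Y : Set (Euc m₂)) (φ : Euc m₁ → Euc m₂ → ℝ)
    (xs : Euc m₁) (ys : Euc m₂) : Prop :=
  xs ∈ X ∧ ys ∈ Y ∧ (∀ y ∈ Y, φ xs y ≤ φ xs ys) ∧ (∀ x ∈ X, φ xs ys ≤ φ x ys)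

/-- The sum objective function of a subnetwork. -/
def sumObjective {n m₁ m₂ : ℕ} (f : Fin n → Euc m₁ → Euc m₂ → ℝ) (x : Euc m₁) (y : Euc m₂) : ℝ :=
  ∑ i, f i x y

/-! ### The time-varying network -/

/-- The neighbours of node `i` when the weights are `M`: those `j` for which the weight `M i j` of
the arc `(j, i)` is positive. -/
def neighbors {n m : ℕ} (M : Matrix (Fin n) (Fin m) ℝ) (i : Fin n) : Finset (Fin m) :=
  Finset.univ.filter (fun j => 0 < M i j)

/-- The communication structure of two subnetworks of `n₁` and `n₂` agents. `A₁ k`, `A₂ k` are the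
weighted adjacency matrices of the subnetworks at time `k`; `B₁ k i j` is the weight of the arc from
agent `j` of the second subnetwork to agent `i` of the first, and `B₂ k i j` that of the arc from
agent `j` of the first subnetwork to agent `i` of the second. An arc is present exactly when its
weight is positive, and every node has a self-loop. -/
structure Network (n₁ n₂ : ℕ) where
  A₁ : ℕ → Matrix (Fin n₁) (Fin n₁) ℝ
  A₂ : ℕ → Matrix (Fin n₂) (Fin n₂) ℝ
  B₁ : ℕ → Matrix (Fin n₁) (Fin n₂) ℝ
  B₂ : ℕ → Matrix (Fin n₂) (Fin n₁) ℝ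
  A₁_nonneg : ∀ k i j, 0 ≤ A₁ k i j
  A₂_nonneg : ∀ k i j, 0 ≤ A₂ k i j
  B₁_nonneg : ∀ k i j, 0 ≤ B₁ k i j
  B₂_nonneg : ∀ k i j, 0 ≤ B₂ k i j
  A₁_loop : ∀ k i, 0 < A₁ k i i
  A₂_loop : ∀ k i, 0 < A₂ k i i

/-- There is an arc `(j, i)` in the union of the graphs of `A s`, `k ≤ s < k + T`. -/
def unionArc {n : ℕ} (A : ℕ → Matrix (Fin n) (Fin n) ℝ) (k T : ℕ) (j i : Fin n) : Prop :=
  ∃ s, k ≤ s ∧ s < k + T ∧ j ∈ neighbors (A s) i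

/-- Uniformly jointly strongly connected. -/
def UJSC {n : ℕ} (A : ℕ → Matrix (Fin n) (Fin n) ℝ) : Prop :=
  ∃ T : ℕ, 0 < T ∧ ∀ k i j, Relation.ReflTransGen (unionArc A k T) i j

/-- Connectivity: the interconnection graph is uniformly jointly bipartite without isolated nodes,
and both subnetworks are uniformly jointly strongly connected. -/
def Connectivity {n₁ n₂ : ℕ} (N : Network n₁ n₂) : Prop :=
  (∃ T : ℕ, 0 < T ∧ ∀ k,
    (∀ i, ∃ s, k ≤ s ∧ s < k + T ∧ (neighbors (N.B₁ s) i).Nonempty) ∧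
    (∀ i, ∃ s, k ≤ s ∧ s < k + T ∧ (neighbors (N.B₂ s) i).Nonempty)) ∧
  UJSC N.A₁ ∧ UJSC N.A₂

/-- The weights of all arcs are at least `η`. -/
def WeightsAtLeast {n m : ℕ} (η : ℝ) (M : ℕ → Matrix (Fin n) (Fin m) ℝ) : Prop :=
  ∀ k i, ∀ j ∈ neighbors (M k) i, η ≤ M k i j

/-- Weight rule: the weights of arcs are bounded below by some `η ∈ (0, 1)`, the weights that an
agent gives to its neighbours in its own subnetwork sum to one, and so do those that it gives to its
neighbours in the other subnetwork at every time when it has one. -/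
def WeightRule {n₁ n₂ : ℕ} (N : Network n₁ n₂) : Prop :=
  (∃ η : ℝ, 0 < η ∧ η < 1 ∧ WeightsAtLeast η N.A₁ ∧ WeightsAtLeast η N.A₂ ∧
    WeightsAtLeast η N.B₁ ∧ WeightsAtLeast η N.B₂) ∧
  (∀ k i, ∑ j ∈ neighbors (N.A₁ k) i, N.A₁ k i j = 1) ∧
  (∀ k i, ∑ j ∈ neighbors (N.A₂ k) i, N.A₂ k i j = 1) ∧
  (∀ s i, (neighbors (N.B₁ s) i).Nonempty → ∑ j ∈ neighbors (N.B₁ s) i, N.B₁ s i j = 1) ∧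
  (∀ s i, (neighbors (N.B₂ s) i).Nonempty → ∑ j ∈ neighbors (N.B₂ s) i, N.B₂ s i j = 1)

/-- Existence of saddle points of all the weighted objectives `∑ μ_i f_i`, `μ` stochastic. -/
def SaddlePointsExist {n m₁ m₂ : ℕ} (X : Set (Euc m₁)) (Y : Set (Euc m₂))
    (f : Fin n → Euc m₁ → Euc m₂ → ℝ) : Prop :=
  ∀ μ ∈ stdSimplex ℝ (Fin n), ∃ xs ys, IsSaddlePoint X Y (fun x y => ∑ i, μ i * f i x y) xs ys

/-- Boundedness of subgradients. -/
def SubgradientsBounded {n₁ n₂ m₁ m₂ : ℕ} (X : Set (Euc m₁)) (Y : Set (Euc m₂))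
    (f : Fin n₁ → Euc m₁ → Euc m₂ → ℝ) (g : Fin n₂ → Euc m₁ → Euc m₂ → ℝ) : Prop :=
  ∃ L : ℝ, 0 < L ∧ ∀ x ∈ X, ∀ y ∈ Y,
    (∀ i, ∀ q ∈ convexSubdiff (fun x' => f i x' y) x, ‖q‖ ≤ L) ∧
    (∀ j, ∀ q ∈ concaveSubdiff (fun y' => g j x y') y, ‖q‖ ≤ L)

/-! ### The algorithm -/

/-- The weighted average, with weights `M i j`, of the states `z j` of the neighbours of `i`. -/
def neighborAverage {n m d : ℕ} (M : Matrix (Fin n) (Fin m) ℝ) (z : Fin m → Euc d) (i : Fin n) :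
    Euc d :=
  ∑ j ∈ neighbors M i, M i j • z j

/-- `s` is the last time up to `k` at which agent `i` has a neighbour in the other subnetwork. -/
def IsLastContact {n m : ℕ} (B : ℕ → Matrix (Fin n) (Fin m) ℝ) (i : Fin n) (k s : ℕ) : Prop :=
  IsGreatest {t | t ≤ k ∧ (neighbors (B t) i).Nonempty} s

/-- `x k i`, `y k i` are states produced by the distributed Nash equilibrium computation algorithm
with stepsizes `α k i`, `β k i`, from arbitrary initial states and with arbitrary choices of the
subgradients `q₁`, `q₂`. `xb`, `yb` are the averages of the latest states received from the other
subnetwork; they are arbitrary as long as an agent has not yet had any contact with it. -/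
def IsRun {n₁ n₂ m₁ m₂ : ℕ} (X : Set (Euc m₁)) (Y : Set (Euc m₂))
    (f : Fin n₁ → Euc m₁ → Euc m₂ → ℝ) (g : Fin n₂ → Euc m₁ → Euc m₂ → ℝ) (N : Network n₁ n₂)
    (α : ℕ → Fin n₁ → ℝ) (β : ℕ → Fin n₂ → ℝ)
    (x : ℕ → Fin n₁ → Euc m₁) (y : ℕ → Fin n₂ → Euc m₂) : Prop :=
  ∃ (xb : ℕ → Fin n₁ → Euc m₂) (yb : ℕ → Fin n₂ → Euc m₁)
    (q₁ : ℕ → Fin n₁ → Euc m₁) (q₂ : ℕ → Fin n₂ → Euc m₂),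
    (∀ k i s, IsLastContact N.B₁ i k s → xb k i = neighborAverage (N.B₁ s) (y s) i) ∧
    (∀ k i s, IsLastContact N.B₂ i k s → yb k i = neighborAverage (N.B₂ s) (x s) i) ∧
    (∀ k i, q₁ k i ∈
      convexSubdiff (fun x' => f i x' (xb k i)) (neighborAverage (N.A₁ k) (x k) i)) ∧
    (∀ k i, q₂ k i ∈
      concaveSubdiff (fun y' => g i (yb k i) y') (neighborAverage (N.A₂ k) (y k) i)) ∧
    (∀ k i, IsProjection X (neighborAverage (N.A₁ k) (x k) i - α k i • q₁ k i) (x (k + 1) i)) ∧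
    (∀ k i, IsProjection Y (neighborAverage (N.A₂ k) (y k) i + β k i • q₂ k i) (y (k + 1) i))

/-- The network achieves a Nash equilibrium (a saddle point of the sum objective function). -/
def AchievesNash {n₁ n₂ m₁ m₂ : ℕ} (X : Set (Euc m₁)) (Y : Set (Euc m₂))
    (f : Fin n₁ → Euc m₁ → Euc m₂ → ℝ) (g : Fin n₂ → Euc m₁ → Euc m₂ → ℝ) (N : Network n₁ n₂)
    (α : ℕ → Fin n₁ → ℝ) (β : ℕ → Fin n₂ → ℝ) : Prop :=
  ∀ x y, IsRun X Y f g N α β x y →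
    ∃ xs ys, IsSaddlePoint X Y (sumObjective f) xs ys ∧
      (∀ i, Tendsto (fun k => x k i) atTop (𝓝 xs)) ∧
      (∀ i, Tendsto (fun k => y k i) atTop (𝓝 ys))

/-- The conditions on the basic stepsizes `γ_k`. -/
def StepsizeCondition (γ : ℕ → ℝ) : Prop :=
  Tendsto (fun k => γ k * ∑ s ∈ Finset.range k, γ s) atTop (𝓝 0) ∧
    Antitone γ ∧
    Tendsto (fun k => ∑ s ∈ Finset.range k, γ s) atTop atTop ∧
    Summable (fun k => γ k ^ 2)

/-! ### Perron vectors and distributed estimators -/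

/-- The transition matrix `Φ(k, s) = A(k) A(k-1) ⋯ A(s)` for `k ≥ s` (and `1` for `k < s`). -/
def transition {n : ℕ} (A : ℕ → Matrix (Fin n) (Fin n) ℝ) (s : ℕ) : ℕ → Matrix (Fin n) (Fin n) ℝ
  | 0 => if s = 0 then A 0 else 1
  | k + 1 => if s ≤ k + 1 then A (k + 1) * transition A s k else 1

/-- `Φ(r, s)` tends to `𝟏 φ'` as `r → ∞`. -/
def IsPerronLimit {n : ℕ} (A : ℕ → Matrix (Fin n) (Fin n) ℝ) (s : ℕ) (φ : Fin n → ℝ) : Prop :=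
  ∀ i j, Tendsto (fun r => transition A s r i j) atTop (𝓝 (φ j))

/-- An estimation rule: from the sequence of adjacency matrices of a subnetwork it computes the
estimate of agent `i` at time `k`. -/
abbrev Estimator (n : ℕ) : Type := (ℕ → Matrix (Fin n) (Fin n) ℝ) → ℕ → Fin n → ℝ

/-- The information that agent `i` has gathered before time `k` is the same for the weight
sequences `A` and `A'`. At each time an agent learns the weights of its incoming arcs and receives
from its neighbours all that they have gathered before. -/
def SameInfo {n : ℕ} (A A' : ℕ → Matrix (Fin n) (Fin n) ℝ) : ℕ → Fin n → Prop
  | 0, _ => True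
  | k + 1, i => SameInfo A A' k i ∧
      (∀ j ∈ neighbors (A k) i ∪ neighbors (A' k) i, A k i j = A' k i j) ∧
      (∀ j ∈ neighbors (A k) i, SameInfo A A' k j)

/-- The estimate of agent `i` at time `k` depends only on what agent `i` has learned from its own
weights and from its neighbours at the times `s ≤ k`. -/
def IsDistributed {n : ℕ} (est : Estimator n) : Prop :=
  ∀ A A' k i, SameInfo A A' (k + 1) i → est A k i = est A' k i

/-- The estimates are positive, and their difference from the `i`-th entry of the vector `φ(k+1)`,
where `lim_r Φ(r, k+1) = 𝟏 φ(k+1)'`, tends to zero. -/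
def LearnsPerron {n : ℕ} (A : ℕ → Matrix (Fin n) (Fin n) ℝ) (est : Estimator n) : Prop :=
  (∀ k i, 0 < est A k i) ∧
    ∃ φ : ℕ → Fin n → ℝ, (∀ s, IsPerronLimit A s (φ s)) ∧
      ∀ i, Tendsto (fun k => est A k i - φ (k + 1) i) atTop (𝓝 0)

/-- The consensus dynamics for auxiliary vectors started at time `t`: `auxState A t s i` is the
vector held by agent `i` at time `s`. At time `t` (and, by convention, before) it is the `i`-th unit
vector; at later times it is the weighted average of the vectors of the neighbours. -/
def auxState {n : ℕ} (A : ℕ → Matrix (Fin n) (Fin n) ℝ) (t : ℕ) : ℕ → Fin n → Fin n → ℝ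
  | 0 => fun i j => if j = i then 1 else 0
  | s + 1 => fun i j =>
      if s + 1 ≤ t then (if j = i then 1 else 0)
      else ∑ l ∈ neighbors (A s) i, A s i l * auxState A t s l j

/-- The estimate is the own entry of the auxiliary vector started at time `0`. -/
def consensusEstimator (n : ℕ) : Estimator n := fun A k i => auxState A 0 k i i

/-- For period `p` there are `p` auxiliary dynamics, the `ν`-th started at time `ν + 1`; at the
times `k = r p + ν` the estimate is the own entry of the `ν`-th auxiliary vector. -/
def periodicEstimator (n p : ℕ) : Estimator n := fun A k i => auxState A (k % p + 1) k i i

/-- The stepsizes `γ_k` divided by the estimates. -/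
def learnedStepsize {n : ℕ} (A : ℕ → Matrix (Fin n) (Fin n) ℝ) (est : Estimator n) (γ : ℕ → ℝ) :
    ℕ → Fin n → ℝ :=
  fun k i => 1 / est A k i * γ k

/-! ### The two cases -/

/-- The matrices `A k` have a common left eigenvector for the eigenvalue one. -/
def HasCommonLeftEigenvector {n : ℕ} (A : ℕ → Matrix (Fin n) (Fin n) ℝ) : Prop :=
  ∃ v : Fin n → ℝ, v ≠ 0 ∧ ∀ k, Matrix.vecMul v (A k) = v

/-- The matrices `A k` switch periodically, with period `p`, among stochastic matrices `S s`. -/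
def SwitchesPeriodically {n : ℕ} (A : ℕ → Matrix (Fin n) (Fin n) ℝ) (p : ℕ) : Prop :=
  0 < p ∧ ∃ S : Fin p → Matrix (Fin n) (Fin n) ℝ,
    (∀ s, S s ∈ Matrix.rowStochastic ℝ (Fin n)) ∧ ∀ (r : ℕ) (s : Fin p), A (r * p + s) = S s

end

noncomputable section

/-! ### Products of stochastic matrices -/

/-! Let `(xs, ys)` be a saddle point of `U` and let `φ₁ k`, `φ₂ k` be the Perron limits of the
products of weights started at time `k`. The Lyapunov function is `V k = ∑ φ₁ k i ‖x k i - xs‖² + ∑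
φ₂ k j ‖y k j - ys‖²`.

The Perron vectors satisfy `φ(k)' = φ(k+1)' A(k)`, so by convexity of the squared norm the averaging
step does not increase `V` (`sum_average_le`). The projected subgradient step of agent `i` then
lowers it by about `2 γ k (φ(k+1) i / est k i)` times a difference of values of `f i`. The ratio
tends to one precisely because the estimates learn the Perron entries, so the contributions of the
agents add up, in the limit with equal weights, to a difference of values of `U` (`agent_step_le`,
`exists_drift`). This uses that the states of each subnetwork reach consensus
(`tendsto_sub_of_consensus`) and that the information on the other subnetwork, whose delay is
bounded, is asymptotically correct (`tendsto_received_sub`).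

When the two subnetworks are added, `U(x, y)` cancels and the descent is `U(x, ys) - U(xs, y)`. By
strict convexity-concavity it grows at least linearly away from the saddle point
(`StrictConvexOn.exists_linear_growth`). All the errors are `o(1) (1 + ‖x‖ + ‖y‖)`: `f i` need not
be Lipschitz in its second argument, but it is so with a constant of linear growth
(`exists_lipschitz_linear_growth`). Linear descent beats such errors without any prior bound on the
states, and `∑ γ = ∞` forces `V → 0` (`tendsto_zero_of_perturbed_descent`). The Perron entries are
bounded below, so every state converges.

As for the estimators, an auxiliary vector holds a row of a product of the weights, and its own
entry tends to the Perron entry at its start time. That entry is constant in time in case (i) and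
periodic in case (ii). -/

theorem sum_neighbors_eq {n m : ℕ} {M : Matrix (Fin n) (Fin m) ℝ} (hM : ∀ i j, 0 ≤ M i j)
    {E : Type*} [AddCommGroup E] [Module ℝ E] (z : Fin m → E) (i : Fin n) :
    ∑ j ∈ neighbors M i, M i j • z j = ∑ j, M i j • z j := by
  refine Finset.sum_subset (Finset.subset_univ _) fun j _ hj => ?_
  have : M i j = 0 := le_antisymm (by simpa [neighbors] using hj) (hM i j)
  simp [this]

/-- Row-stochastic weights with self-loops, bounded below on the arcs by `η`, whose graphs are
uniformly jointly strongly connected. -/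
structure ConsensusWeights {n : ℕ} (A : ℕ → Matrix (Fin n) (Fin n) ℝ) (η : ℝ) : Prop where
  eta_pos : 0 < η
  nonneg : ∀ k i j, 0 ≤ A k i j
  row_sum : ∀ k i, ∑ j, A k i j = 1
  loop : ∀ k i, 0 < A k i i
  lower : ∀ k i j, 0 < A k i j → η ≤ A k i j
  ujsc : UJSC A

/-- `A (s + w - 1) ⋯ A (s + 1) A s`, a product of `w` factors. -/
def stepProd {n : ℕ} (A : ℕ → Matrix (Fin n) (Fin n) ℝ) (s : ℕ) : ℕ → Matrix (Fin n) (Fin n) ℝ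
  | 0 => 1
  | w + 1 => A (s + w) * stepProd A s w

section

variable {n : ℕ} {A : ℕ → Matrix (Fin n) (Fin n) ℝ} {η : ℝ}

theorem ConsensusWeights.shift (hA : ConsensusWeights A η) (s : ℕ) :
    ConsensusWeights (fun k => A (s + k)) η where
  eta_pos := hA.eta_pos
  nonneg k := hA.nonneg _
  row_sum k := hA.row_sum _
  loop k := hA.loop _
  lower k := hA.lower _
  ujsc := by
    obtain ⟨T, hT, h⟩ := hA.ujsc
    refine ⟨T, hT, fun k i j => Relation.ReflTransGen.mono ?_ _ _ (h (s + k) i j)⟩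
    rintro a b ⟨t, h1, h2, h3⟩
    refine ⟨t - s, by omega, by omega, ?_⟩
    have : s + (t - s) = t := by omega
    simpa [this] using h3

theorem stepProd_add (A : ℕ → Matrix (Fin n) (Fin n) ℝ) (s v w : ℕ) :
    stepProd A s (v + w) = stepProd A (s + v) w * stepProd A s v := by
  induction w with
  | zero => simp [stepProd]
  | succ w ih => rw [← add_assoc, stepProd, ih, stepProd, Matrix.mul_assoc, add_assoc]

theorem stepProd_succ' (A : ℕ → Matrix (Fin n) (Fin n) ℝ) (s w : ℕ) :
    stepProd A s (w + 1) = stepProd A (s + 1) w * A s := by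
  rw [add_comm w 1, stepProd_add]; simp [stepProd]

theorem transition_of_lt (A : ℕ → Matrix (Fin n) (Fin n) ℝ) {s k : ℕ} (h : k < s) :
    transition A s k = 1 := by
  cases k with
  | zero => simp [transition, h.ne']
  | succ k => simp [transition, h]

theorem transition_add (A : ℕ → Matrix (Fin n) (Fin n) ℝ) (s w : ℕ) :
    transition A s (s + w) = stepProd A s (w + 1) := by
  induction w with
  | zero =>
    cases s with
    | zero => simp [transition, stepProd]
    | succ s => simp [transition, stepProd, transition_of_lt]
  | succ w ih =>
    rw [← add_assoc, transition, ih, if_pos (by omega), stepProd.eq_def A s (w + 1 + 1)]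
    rfl

/-- Passes from indexing by the last time, which is inclusive, to indexing by the number of factors,
in which products concatenate without case distinctions. -/
theorem isPerronLimit_iff {s : ℕ} {φ : Fin n → ℝ} :
    IsPerronLimit A s φ ↔ ∀ i j, Tendsto (fun w => stepProd A s w i j) atTop (𝓝 (φ j)) := by
  refine forall₂_congr fun i j => ?_
  rw [← tendsto_add_atTop_iff_nat s, ← tendsto_add_atTop_iff_nat (f := fun w => stepProd A s w i j) 1]
  refine tendsto_congr fun w => ?_
  rw [add_comm w s, transition_add]

/-! ### Sign pattern and uniform lower bounds of the products. -/

theorem stepProd_nonneg (hA : ConsensusWeights A η) (s w : ℕ) (i j : Fin n) :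
    0 ≤ stepProd A s w i j := by
  induction w generalizing i with
  | zero => simp only [stepProd, Matrix.one_apply]; split_ifs <;> norm_num
  | succ w ih =>
    rw [stepProd, Matrix.mul_apply]
    exact Finset.sum_nonneg fun l _ => mul_nonneg (hA.nonneg _ _ _) (ih l)

theorem stepProd_row_sum (hA : ConsensusWeights A η) (s w : ℕ) (i : Fin n) :
    ∑ j, stepProd A s w i j = 1 := by
  induction w generalizing i with
  | zero => simp [stepProd, Matrix.one_apply]
  | succ w ih =>
    simp only [stepProd, Matrix.mul_apply]
    rw [Finset.sum_comm]
    simp [← Finset.mul_sum, ih, hA.row_sum]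

theorem stepProd_pos_of_arc (hA : ConsensusWeights A η) {s w : ℕ} {i l j : Fin n}
    (h : 0 < A (s + w) i l) (h' : 0 < stepProd A s w l j) : 0 < stepProd A s (w + 1) i j := by
  rw [stepProd, Matrix.mul_apply]
  exact (mul_pos h h').trans_le (Finset.single_le_sum
    (f := fun l => A (s + w) i l * stepProd A s w l j)
    (fun l _ => mul_nonneg (hA.nonneg _ _ _) (stepProd_nonneg hA _ _ _ _)) (Finset.mem_univ l))

theorem stepProd_pos_mono (hA : ConsensusWeights A η) {s v w : ℕ} (h : v ≤ w) {i j : Fin n}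
    (hp : 0 < stepProd A s v i j) : 0 < stepProd A s w i j := by
  induction w, h using Nat.le_induction with
  | base => exact hp
  | succ w _ ih => exact stepProd_pos_of_arc hA (hA.loop _ _) ih

theorem stepProd_diag_pos (hA : ConsensusWeights A η) (s w : ℕ) (i : Fin n) :
    0 < stepProd A s w i i :=
  stepProd_pos_mono hA (Nat.zero_le w) (by simp [stepProd])

/-- A positive entry contains a positive path product, each of whose factors is at least `η`. -/
theorem stepProd_lower (hA : ConsensusWeights A η) (s w : ℕ) (i j : Fin n)
    (hp : 0 < stepProd A s w i j) : η ^ w ≤ stepProd A s w i j := by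
  induction w generalizing i with
  | zero =>
    simp only [stepProd, Matrix.one_apply, pow_zero] at hp ⊢
    split_ifs at hp ⊢ <;> simp_all
  | succ w ih =>
    have hnn : ∀ l ∈ Finset.univ, 0 ≤ A (s + w) i l * stepProd A s w l j :=
      fun l _ => mul_nonneg (hA.nonneg _ _ _) (stepProd_nonneg hA _ _ _ _)
    rw [stepProd, Matrix.mul_apply] at hp ⊢
    obtain ⟨l, -, hl⟩ : ∃ l ∈ Finset.univ, 0 < A (s + w) i l * stepProd A s w l j := by
      by_contra! hc
      exact absurd (Finset.sum_nonpos hc) (not_le.2 hp)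
    have h1 : 0 < A (s + w) i l := (hA.nonneg _ _ _).lt_of_ne (by rintro h; simp [← h] at hl)
    have h2 : 0 < stepProd A s w l j :=
      (stepProd_nonneg hA _ _ _ _).lt_of_ne (by rintro h; simp [← h] at hl)
    calc η ^ (w + 1) = η * η ^ w := pow_succ' _ _
      _ ≤ A (s + w) i l * stepProd A s w l j :=
        mul_le_mul (hA.lower _ _ _ h1) (ih l h2) (pow_nonneg hA.eta_pos.le _) h1.le
      _ ≤ _ := Finset.single_le_sum hnn (Finset.mem_univ l)

/-- A relation whose reflexive transitive closure connects a point of `S` to one outside has a pair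
that leaves `S`. -/
theorem exists_rel_exit {α : Type*} {r : α → α → Prop} {S : Set α} {a b : α}
    (h : Relation.ReflTransGen r a b) (ha : a ∈ S) (hb : b ∉ S) :
    ∃ c d, r c d ∧ c ∈ S ∧ d ∉ S := by
  induction h with
  | refl => exact absurd ha hb
  | @tail c d _ hcd ih =>
    by_cases hc : c ∈ S
    · exact ⟨c, d, hcd, hc, hb⟩
    · exact ih hc

/-- The set of agents reached from `j` never shrinks, because of the self-loops. As long as it is
not everything, some arc of the next window of length `T` leaves it, so each window adds at least
one agent. -/
theorem card_reach_ge (hA : ConsensusWeights A η) {T : ℕ}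
    (hT : ∀ k i j, Relation.ReflTransGen (unionArc A k T) i j) (s : ℕ) (j : Fin n) (m : ℕ) :
    min n (m + 1) ≤ (Finset.univ.filter fun i => 0 < stepProd A s (m * T) i j).card := by
  induction m with
  | zero =>
    have : j ∈ Finset.univ.filter fun i => 0 < stepProd A s (0 * T) i j := by
      simp [stepProd]
    have := Finset.card_pos.2 ⟨j, this⟩
    omega
  | succ m ih =>
    set R := fun m => Finset.univ.filter fun i => 0 < stepProd A s (m * T) i j with hR
    change min n (m + 1) ≤ (R m).card at ih
    change min n (m + 1 + 1) ≤ (R (m + 1)).card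
    have hsub : R m ⊆ R (m + 1) := fun i hi => by
      simp only [hR, Finset.mem_filter, Finset.mem_univ, true_and] at hi ⊢
      exact stepProd_pos_mono hA (Nat.mul_le_mul_right T (Nat.le_succ m)) hi
    by_cases hfull : R m = Finset.univ
    · have : R (m + 1) = Finset.univ := Finset.univ_subset_iff.1 (hfull ▸ hsub)
      rw [this, Finset.card_univ, Fintype.card_fin]
      exact min_le_left _ _
    obtain ⟨b, hb⟩ : ∃ b, b ∉ R m := by
      by_contra! h
      exact hfull (Finset.eq_univ_iff_forall.2 h)
    have hj : j ∈ R m := by simpa [hR] using stepProd_diag_pos hA s (m * T) j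
    obtain ⟨c, d, ⟨t, ht1, ht2, hcd⟩, hc, hd⟩ :=
      exists_rel_exit (S := (R m : Set (Fin n))) (hT (s + m * T) j b) hj hb
    have hd' : d ∈ R (m + 1) := by
      have hc' : 0 < stepProd A s (m * T) c j := by simpa [hR] using hc
      have h1 : 0 < stepProd A s (t - s) c j := stepProd_pos_mono hA (by omega) hc'
      have h2 : 0 < A (s + (t - s)) d c := by
        rw [show s + (t - s) = t by omega]
        simpa [neighbors] using hcd
      have h3 := stepProd_pos_of_arc hA h2 h1
      have h4 : t - s + 1 ≤ (m + 1) * T := by rw [Nat.succ_mul]; omega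
      simpa [hR] using stepProd_pos_mono hA h4 h3
    have hlt : (R m).card < (R (m + 1)).card :=
      Finset.card_lt_card ⟨hsub, fun h => hd (h hd')⟩
    omega

/-- After a fixed number of steps all the entries of the products are bounded below. -/
theorem exists_stepProd_lower (hA : ConsensusWeights A η) :
    ∃ W : ℕ, 0 < W ∧ ∃ δ : ℝ, 0 < δ ∧ ∀ s i j, δ ≤ stepProd A s W i j := by
  obtain ⟨T, hT0, hT⟩ := hA.ujsc
  -- Already `n - 1` windows reach every agent; `n + 1` avoids truncated subtraction and keeps the
  -- number of steps positive.
  refine ⟨(n + 1) * T, by positivity, η ^ ((n + 1) * T), pow_pos hA.eta_pos _, fun s i j => ?_⟩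
  apply stepProd_lower hA
  have h := card_reach_ge hA hT s j (n + 1)
  have h' : (Finset.univ.filter fun i => 0 < stepProd A s ((n + 1) * T) i j) = Finset.univ := by
    rw [← Finset.card_eq_iff_eq_univ, Fintype.card_fin]
    refine le_antisymm ?_ (by omega)
    simpa using Finset.card_le_univ (Finset.univ.filter fun i => 0 < stepProd A s ((n + 1) * T) i j)
  have := Finset.eq_univ_iff_forall.1 h' i
  simpa using this

/-! ### Consensus -/

/-- The difference of the two averages is the average of `x j - x l` under the product weights `p j
* q l`. Its diagonal terms vanish, and the diagonal carries mass at least `∑ p j * δ = δ`. -/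
theorem norm_sum_smul_sub_le {E : Type*} [NormedAddCommGroup E] [NormedSpace ℝ E] {p q : Fin n → ℝ}
    {δ : ℝ} (hδ : 0 ≤ δ) (hp : ∀ j, 0 ≤ p j) (hp1 : ∑ j, p j = 1) (hq : ∀ j, δ ≤ q j)
    (hq1 : ∑ j, q j = 1) {x : Fin n → E} {D : ℝ} (hD : ∀ i j, ‖x i - x j‖ ≤ D) :
    ‖∑ j, p j • x j - ∑ j, q j • x j‖ ≤ (1 - δ) * D := by
  rcases isEmpty_or_nonempty (Fin n) with h | ⟨⟨i⟩⟩
  · simp at hp1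
  have hD0 : 0 ≤ D := (norm_nonneg _).trans (hD i i)
  have h1 : ∑ j, p j • x j - ∑ j, q j • x j = ∑ j, ∑ l, (p j * q l) • (x j - x l) := by
    simp only [smul_sub, Finset.sum_sub_distrib]
    congr 1
    · refine Finset.sum_congr rfl fun j _ => ?_
      rw [← Finset.sum_smul, ← Finset.mul_sum, hq1, mul_one]
    · rw [Finset.sum_comm]
      refine Finset.sum_congr rfl fun j _ => ?_
      rw [← Finset.sum_smul, ← Finset.sum_mul, hp1, one_mul]
  have h2 : ∀ j l, ‖(p j * q l) • (x j - x l)‖ ≤ p j * q l * D - if j = l then p j * q l * D else 0 := by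
    intro j l
    have hpq : 0 ≤ p j * q l := mul_nonneg (hp j) (hδ.trans (hq l))
    split_ifs with hjl
    · simp [hjl]
    · rw [norm_smul, Real.norm_of_nonneg hpq, sub_zero]
      exact mul_le_mul_of_nonneg_left (hD j l) hpq
  rw [h1]
  calc ‖∑ j, ∑ l, (p j * q l) • (x j - x l)‖
      ≤ ∑ j, ∑ l, (p j * q l * D - if j = l then p j * q l * D else 0) :=
        (norm_sum_le _ _).trans (Finset.sum_le_sum fun j _ => (norm_sum_le _ _).trans
          (Finset.sum_le_sum fun l _ => h2 j l))
    _ = D - ∑ j, p j * q j * D := by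
        simp only [Finset.sum_sub_distrib, Finset.sum_ite_eq, Finset.mem_univ, if_true]
        simp [← Finset.sum_mul, ← Finset.mul_sum, hq1, hp1]
    _ ≤ D - ∑ j, p j * δ * D := by
        gcongr with j
        · exact hp j
        · exact hq j
    _ = (1 - δ) * D := by rw [← Finset.sum_mul, ← Finset.sum_mul, hp1]; ring

theorem tendsto_zero_of_contraction {D ε : ℕ → ℝ} {W : ℕ} (hW : 0 < W) {ρ : ℝ} (hρ0 : 0 ≤ ρ)
    (hρ : ρ < 1) (hD : ∀ k, 0 ≤ D k) (hε : Tendsto ε atTop (𝓝 0))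
    (h : ∀ k, D (k + W) ≤ ρ * D k + ε k) : Tendsto D atTop (𝓝 0) := by
  rw [Metric.tendsto_atTop]
  intro θ hθ
  obtain ⟨K, hK⟩ := eventually_atTop.1 (hε.eventually (gt_mem_nhds
    (show 0 < (1 - ρ) * (θ / 2) by have := sub_pos.2 hρ; positivity)))
  set M := ∑ r ∈ Finset.range W, D (K + r) with hM
  have hM0 : 0 ≤ M := Finset.sum_nonneg fun _ _ => hD _
  -- Each residue class modulo `W` is followed separately. The threshold on `ε` makes `θ / 2` a
  -- fixed point of the recursion: `ρ (θ / 2) + (1 - ρ) (θ / 2) = θ / 2`.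
  have key : ∀ m r, r < W → D (K + r + m * W) ≤ θ / 2 + ρ ^ m * M := by
    intro m r hr
    induction m with
    | zero =>
      have := Finset.single_le_sum (f := fun r => D (K + r)) (fun _ _ => hD _) (Finset.mem_range.2 hr)
      simp only [zero_mul, add_zero, pow_zero, one_mul]
      linarith
    | succ m ih =>
      have h1 := h (K + r + m * W)
      have h2 := hK (K + r + m * W) (by omega)
      rw [show K + r + (m + 1) * W = K + r + m * W + W by ring]
      have h3 := mul_le_mul_of_nonneg_left ih hρ0
      rw [pow_succ']
      nlinarith
  have hlim : Tendsto (fun m => ρ ^ m * M) atTop (𝓝 0) := by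
    simpa using (tendsto_pow_atTop_nhds_zero_of_lt_one hρ0 hρ).mul_const M
  obtain ⟨m₀, hm₀⟩ := eventually_atTop.1 (hlim.eventually (gt_mem_nhds (half_pos hθ)))
  refine ⟨K + m₀ * W, fun k hk => ?_⟩
  have hk' : k = K + (k - K) % W + (k - K) / W * W := by
    have := Nat.mod_add_div (k - K) W
    rw [mul_comm] at this
    omega
  have h1 := key ((k - K) / W) ((k - K) % W) (Nat.mod_lt _ hW)
  rw [← hk'] at h1
  have h2 := hm₀ ((k - K) / W) ((Nat.le_div_iff_mul_le hW).2 (by omega))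
  rw [Real.dist_0_eq_abs, abs_of_nonneg (hD k)]
  linarith

variable {E : Type*} [NormedAddCommGroup E] [NormedSpace ℝ E]

/-- Averaging with stochastic weights does not amplify earlier disturbances, so they merely add up.
-/
theorem norm_sub_stepProd_le (hA : ConsensusWeights A η) {x e : ℕ → Fin n → E}
    (hx : ∀ k i, x (k + 1) i = ∑ j, A k i j • x k j + e k i) (k w : ℕ) (i : Fin n) :
    ‖x (k + w) i - ∑ j, stepProd A k w i j • x k j‖ ≤
      ∑ t ∈ Finset.range w, ∑ i, ‖e (k + t) i‖ := by
  induction w generalizing i with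
  | zero => simp [stepProd, Matrix.one_apply]
  | succ w ih =>
    have h1 : x (k + (w + 1)) i - ∑ j, stepProd A k (w + 1) i j • x k j =
        ∑ l, A (k + w) i l • (x (k + w) l - ∑ j, stepProd A k w l j • x k j) + e (k + w) i := by
      rw [← add_assoc, hx]
      simp only [stepProd, Matrix.mul_apply, Finset.sum_smul, smul_sub, Finset.sum_sub_distrib,
        Finset.smul_sum, smul_smul]
      rw [Finset.sum_comm]
      abel
    rw [h1, Finset.sum_range_succ]
    refine (norm_add_le _ _).trans (add_le_add ?_ ?_)
    · calc _ ≤ ∑ l, A (k + w) i l * ∑ t ∈ Finset.range w, ∑ i, ‖e (k + t) i‖ := by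
            refine (norm_sum_le _ _).trans (Finset.sum_le_sum fun l _ => ?_)
            rw [norm_smul, Real.norm_of_nonneg (hA.nonneg _ _ _)]
            exact mul_le_mul_of_nonneg_left (ih l) (hA.nonneg _ _ _)
        _ = _ := by rw [← Finset.sum_mul, hA.row_sum, one_mul]
    · exact Finset.single_le_sum (f := fun i => ‖e (k + w) i‖) (fun _ _ => norm_nonneg _)
        (Finset.mem_univ i)

/-- Consensus under vanishing disturbances. -/
theorem tendsto_sub_of_consensus (hA : ConsensusWeights A η) {x e : ℕ → Fin n → E}
    (hx : ∀ k i, x (k + 1) i = ∑ j, A k i j • x k j + e k i)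
    (he : ∀ i, Tendsto (fun k => e k i) atTop (𝓝 0)) (i j : Fin n) :
    Tendsto (fun k => x k i - x k j) atTop (𝓝 0) := by
  obtain ⟨W, hW, δ, hδ, hP⟩ := exists_stepProd_lower hA
  have hδ1 : δ ≤ 1 := by
    rw [← stepProd_row_sum hA 0 W i]
    exact (hP 0 i i).trans (Finset.single_le_sum (f := fun j => stepProd A 0 W i j)
      (fun j _ => stepProd_nonneg hA _ _ _ _) (Finset.mem_univ i))
  -- The diameter of the states, as a sup norm over pairs; it contracts by `1 - δ` every `W` steps.
  set D : ℕ → ℝ := fun k => ‖fun p : Fin n × Fin n => x k p.1 - x k p.2‖ with hD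
  have hle : ∀ k i j, ‖x k i - x k j‖ ≤ D k := fun k i j =>
    norm_le_pi_norm (fun p : Fin n × Fin n => x k p.1 - x k p.2) (i, j)
  set ε : ℕ → ℝ := fun k => 2 * ∑ t ∈ Finset.range W, ∑ i, ‖e (k + t) i‖ with hε
  have hε0 : Tendsto ε atTop (𝓝 0) := by
    have : Tendsto ε atTop (𝓝 (2 * ∑ t ∈ Finset.range W, ∑ _i : Fin n, (0 : ℝ))) := by
      refine (tendsto_finsetSum _ fun t _ => tendsto_finsetSum _ fun i _ => ?_).const_mul 2
      simpa using ((tendsto_add_atTop_iff_nat t).2 (he i)).norm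
    simpa using this
  have hD0 : Tendsto D atTop (𝓝 0) := by
    refine tendsto_zero_of_contraction hW (sub_nonneg.2 hδ1) (by linarith : 1 - δ < 1)
      (fun _ => norm_nonneg _) hε0 fun k => ?_
    have hn : 0 ≤ (1 - δ) * D k + ε k := by
      have := mul_nonneg (sub_nonneg.2 hδ1) (norm_nonneg (fun p : Fin n × Fin n => x k p.1 - x k p.2))
      have : 0 ≤ ε k := mul_nonneg zero_le_two
        (Finset.sum_nonneg fun _ _ => Finset.sum_nonneg fun _ _ => norm_nonneg _)
      positivity
    refine (pi_norm_le_iff_of_nonneg hn).2 fun p => ?_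
    have h1 := norm_sub_stepProd_le hA hx k W p.1
    have h2 := norm_sub_stepProd_le hA hx k W p.2
    have h3 := norm_sum_smul_sub_le hδ.le (stepProd_nonneg hA k W p.1) (stepProd_row_sum hA k W p.1)
      (hP k p.2) (stepProd_row_sum hA k W p.2) (hle k)
    have h4 : x (k + W) p.1 - x (k + W) p.2 =
      (x (k + W) p.1 - ∑ j, stepProd A k W p.1 j • x k j) -
      (x (k + W) p.2 - ∑ j, stepProd A k W p.2 j • x k j) +
      (∑ j, stepProd A k W p.1 j • x k j - ∑ j, stepProd A k W p.2 j • x k j) := by abel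
    rw [h4]
    refine (norm_add_le _ _).trans ?_
    have h5 := norm_sub_le (x (k + W) p.1 - ∑ j, stepProd A k W p.1 j • x k j)
      (x (k + W) p.2 - ∑ j, stepProd A k W p.2 j • x k j)
    simp only [hε]
    linarith
  exact squeeze_zero_norm (fun k => hle k i j) hD0

/-! ### Perron vectors -/

/-- Each column of the product follows the undisturbed consensus dynamics, so the rows merge. A
later entry is a convex combination of the earlier entries of the same column, whence each column
entry is a Cauchy sequence. -/
theorem exists_isPerronLimit (hA : ConsensusWeights A η) (s : ℕ) :
    ∃ φ : Fin n → ℝ, IsPerronLimit A s φ := by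
  rcases isEmpty_or_nonempty (Fin n) with h | ⟨⟨i₀⟩⟩
  · exact ⟨0, fun i => isEmptyElim i⟩
  have hdiff : ∀ i l j, Tendsto (fun w => stepProd A s w i j - stepProd A s w l j) atTop (𝓝 0) := by
    intro i l j
    refine tendsto_sub_of_consensus (hA.shift s) (x := fun w i => stepProd A s w i j)
      (e := fun _ _ => 0) (fun k i => ?_) (fun _ => tendsto_const_nhds) i l
    simp [stepProd, Matrix.mul_apply]
  have hlim : ∀ j, ∃ a, Tendsto (fun w => stepProd A s w i₀ j) atTop (𝓝 a) := by
    intro j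
    refine cauchySeq_tendsto_of_complete (cauchySeq_of_le_tendsto_0'
      (fun w => ∑ l, |stepProd A s w i₀ j - stepProd A s w l j|) (fun v w hvw => ?_) ?_)
    · obtain ⟨u, rfl⟩ := Nat.exists_eq_add_of_le hvw
      rw [Real.dist_eq]
      have h1 : stepProd A s v i₀ j - stepProd A s (v + u) i₀ j =
          ∑ l, stepProd A (s + v) u i₀ l * (stepProd A s v i₀ j - stepProd A s v l j) := by
        rw [stepProd_add, Matrix.mul_apply]
        simp only [mul_sub, Finset.sum_sub_distrib, ← Finset.sum_mul]
        rw [stepProd_row_sum hA, one_mul]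
      rw [h1]
      refine (Finset.abs_sum_le_sum_abs _ _).trans (Finset.sum_le_sum fun l _ => ?_)
      rw [abs_mul, abs_of_nonneg (stepProd_nonneg hA _ _ _ _)]
      refine mul_le_of_le_one_left (abs_nonneg _) ?_
      rw [← stepProd_row_sum hA (s + v) u i₀]
      exact Finset.single_le_sum (f := fun l => stepProd A (s + v) u i₀ l)
        (fun l _ => stepProd_nonneg hA _ _ _ _) (Finset.mem_univ l)
    · simpa using tendsto_finsetSum Finset.univ fun l _ => (hdiff i₀ l j).abs
  choose φ hφ using hlim
  refine ⟨φ, isPerronLimit_iff.2 fun i j => ?_⟩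
  simpa using (hdiff i i₀ j).add (hφ j)

theorem IsPerronLimit.unique {s : ℕ} {φ ψ : Fin n → ℝ} (h : IsPerronLimit A s φ)
    (h' : IsPerronLimit A s ψ) : φ = ψ :=
  funext fun j => tendsto_nhds_unique (h j j) (h' j j)

theorem IsPerronLimit.sum_eq_one (hA : ConsensusWeights A η) (hn : 0 < n) {s : ℕ} {φ : Fin n → ℝ}
    (h : IsPerronLimit A s φ) : ∑ j, φ j = 1 := by
  have h1 := tendsto_finsetSum Finset.univ fun j _ => isPerronLimit_iff.1 h ⟨0, hn⟩ j
  simp only [stepProd_row_sum hA] at h1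
  exact tendsto_nhds_unique h1 tendsto_const_nhds |>.symm ▸ rfl

theorem IsPerronLimit.vecMul {s : ℕ} {φ ψ : Fin n → ℝ} (h : IsPerronLimit A s φ)
    (h' : IsPerronLimit A (s + 1) ψ) (j : Fin n) : φ j = ∑ i, ψ i * A s i j := by
  have h1 := (tendsto_add_atTop_iff_nat 1).2 (isPerronLimit_iff.1 h j j)
  have h2 := tendsto_finsetSum Finset.univ fun i _ =>
    (isPerronLimit_iff.1 h' j i).mul_const (A s i j)
  refine tendsto_nhds_unique h1 (h2.congr fun w => ?_)
  rw [stepProd_succ', Matrix.mul_apply]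

/-- The first `W` factors already have all entries at least `δ`, and multiplication from the left by
a stochastic matrix only averages these entries. -/
theorem exists_perron_lower (hA : ConsensusWeights A η) :
    ∃ c : ℝ, 0 < c ∧ ∀ s φ, IsPerronLimit A s φ → ∀ j, c ≤ φ j := by
  obtain ⟨W, -, δ, hδ, hP⟩ := exists_stepProd_lower hA
  refine ⟨δ, hδ, fun s φ h j => ?_⟩
  refine ge_of_tendsto ((tendsto_add_atTop_iff_nat W).2 (isPerronLimit_iff.1 h j j))
    (Eventually.of_forall fun w => ?_)
  rw [add_comm, stepProd_add, Matrix.mul_apply]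
  calc δ = ∑ l, stepProd A (s + W) w j l * δ := by
        rw [← Finset.sum_mul, stepProd_row_sum hA, one_mul]
    _ ≤ _ := Finset.sum_le_sum fun l _ =>
        mul_le_mul_of_nonneg_left (hP s l j) (stepProd_nonneg hA _ _ _ _)

end

/-! ### The estimators -/

section

variable {n : ℕ} {A A' : ℕ → Matrix (Fin n) (Fin n) ℝ} {η : ℝ}

/-- Equal information on the incoming weights includes equal neighbour sets, so the averages run
over the same terms; the rest is induction over time. -/
theorem auxState_congr_of_sameInfo (t s : ℕ) (i : Fin n) (h : SameInfo A A' s i) :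
    auxState A t s i = auxState A' t s i := by
  induction s generalizing i with
  | zero => rfl
  | succ s ih =>
    obtain ⟨-, h1, h2⟩ := h
    have hN : neighbors (A s) i = neighbors (A' s) i := by
      ext j
      constructor <;> intro hj
      · have := h1 j (Finset.mem_union_left _ hj)
        simpa [neighbors, this] using hj
      · have := h1 j (Finset.mem_union_right _ hj)
        simpa [neighbors, this] using hj
    funext j
    simp only [auxState]
    split_ifs
    · rfl
    · rfl
    · rw [← hN]
      refine Finset.sum_congr rfl fun l hl => ?_
      rw [h1 l (Finset.mem_union_left _ hl), ih l (h2 l hl)]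

theorem isDistributed_consensusEstimator (n : ℕ) : IsDistributed (consensusEstimator n) :=
  fun _ _ k i h => congrFun (auxState_congr_of_sameInfo 0 k i h.1) i

theorem isDistributed_periodicEstimator (n p : ℕ) : IsDistributed (periodicEstimator n p) :=
  fun _ _ k i h => congrFun (auxState_congr_of_sameInfo (k % p + 1) k i h.1) i

/-- Truncated subtraction matches the convention that the vectors are unit vectors before the start
time. -/
theorem auxState_eq_stepProd (hA : ∀ k i j, 0 ≤ A k i j) (t s : ℕ) (i j : Fin n) :
    auxState A t s i j = stepProd A t (s - t) i j := by
  induction s generalizing i with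
  | zero => simp [auxState, stepProd, Matrix.one_apply, eq_comm]
  | succ s ih =>
    simp only [auxState]
    split_ifs with h1 h2
    · simp [Nat.sub_eq_zero_of_le h1, stepProd, h2]
    · simp [Nat.sub_eq_zero_of_le h1, stepProd, Ne.symm h2]
    · rw [show s + 1 - t = s - t + 1 by omega, stepProd, Matrix.mul_apply,
        show t + (s - t) = s by omega]
      simp only [ih]
      exact sum_neighbors_eq (hA s) (fun l => stepProd A t (s - t) l j) i

theorem vecMul_stepProd {v : Fin n → ℝ} (hv : ∀ k, Matrix.vecMul v (A k) = v) (s w : ℕ) :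
    Matrix.vecMul v (stepProd A s w) = v := by
  induction w with
  | zero => simp [stepProd]
  | succ w ih => rw [stepProd, ← Matrix.vecMul_vecMul, hv, ih]

/-- The eigenvector `v` is preserved by all products, so in the limit `(∑ v) φ = v`. As `v ≠ 0`, the
sum is nonzero, and `φ` is the normalized `v` whatever the start time. -/
theorem perron_eq_of_common_left_eigenvector (h : HasCommonLeftEigenvector A) {s t : ℕ}
    {φ ψ : Fin n → ℝ} (hφ : IsPerronLimit A s φ) (hψ : IsPerronLimit A t ψ) : φ = ψ := by
  obtain ⟨v, hv0, hv⟩ := h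
  have key : ∀ s φ, IsPerronLimit A s φ → ∀ j, (∑ i, v i) * φ j = v j := by
    intro s φ hφ j
    have h1 := tendsto_finsetSum Finset.univ fun i _ => (isPerronLimit_iff.1 hφ i j).const_mul (v i)
    have h2 : ∀ w, ∑ i, v i * stepProd A s w i j = v j := fun w =>
      congrFun (vecMul_stepProd hv s w) j
    simp only [h2, ← Finset.sum_mul] at h1
    exact tendsto_nhds_unique h1 tendsto_const_nhds
  have hs : ∑ i, v i ≠ 0 := fun h0 => hv0 (funext fun j => by simp [← key s φ hφ j, h0])
  funext j
  exact mul_left_cancel₀ hs ((key s φ hφ j).trans (key t ψ hψ j).symm)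

theorem learnsPerron_consensusEstimator (hA : ConsensusWeights A η)
    (h : HasCommonLeftEigenvector A) : LearnsPerron A (consensusEstimator n) := by
  choose φ hφ using exists_isPerronLimit hA
  refine ⟨fun k i => ?_, φ, hφ, fun i => ?_⟩
  · rw [consensusEstimator, auxState_eq_stepProd hA.nonneg]
    exact stepProd_diag_pos hA _ _ _
  · have h1 : ∀ k, consensusEstimator n A k i - φ (k + 1) i = stepProd A 0 k i i - φ 0 i := by
      intro k
      rw [consensusEstimator, auxState_eq_stepProd hA.nonneg, Nat.sub_zero,
        perron_eq_of_common_left_eigenvector h (hφ (k + 1)) (hφ 0)]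
    simp only [h1]
    simpa using (isPerronLimit_iff.1 (hφ 0) i i).sub_const (φ 0 i)

theorem SwitchesPeriodically.add_period {p : ℕ} (h : SwitchesPeriodically A p) (k : ℕ) :
    A (k + p) = A k := by
  obtain ⟨hp, S, -, hS⟩ := h
  have h1 := hS (k / p) ⟨k % p, Nat.mod_lt _ hp⟩
  have h2 := hS (k / p + 1) ⟨k % p, Nat.mod_lt _ hp⟩
  have h3 : k / p * p + k % p = k := by rw [mul_comm]; exact Nat.div_add_mod k p
  simp only [add_mul, one_mul] at h1 h2
  rw [h3] at h1
  rw [show k / p * p + p + k % p = k + p by omega] at h2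
  rw [h1, h2]

theorem stepProd_add_period {p : ℕ} (h : SwitchesPeriodically A p) (s w : ℕ) :
    stepProd A (s + p) w = stepProd A s w := by
  induction w with
  | zero => rfl
  | succ w ih => rw [stepProd, stepProd, ih, add_right_comm, h.add_period]

theorem perron_eq_of_modEq {p : ℕ} (h : SwitchesPeriodically A p) {φ : ℕ → Fin n → ℝ}
    (hφ : ∀ s, IsPerronLimit A s (φ s)) (s r : ℕ) : φ (s + r * p) = φ s := by
  induction r with
  | zero => simp
  | succ r ih =>
    rw [← ih, show s + (r + 1) * p = s + r * p + p by ring]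
    refine (hφ _).unique (isPerronLimit_iff.2 fun i j => ?_)
    simp only [stepProd_add_period h]
    exact isPerronLimit_iff.1 (hφ _) i j

theorem learnsPerron_periodicEstimator (hA : ConsensusWeights A η) {p : ℕ}
    (h : SwitchesPeriodically A p) : LearnsPerron A (periodicEstimator n p) := by
  choose φ hφ using exists_isPerronLimit hA
  refine ⟨fun k i => ?_, φ, hφ, fun i => ?_⟩
  · rw [periodicEstimator, auxState_eq_stepProd hA.nonneg]
    exact stepProd_diag_pos hA _ _ _
  · rw [Metric.tendsto_atTop]
    intro ε hε
    -- There are only `p` auxiliary dynamics, so a single `W` serves them all.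
    have h1 : ∀ ν ∈ Finset.range p, ∀ᶠ w in atTop,
        dist (stepProd A (ν + 1) w i i) (φ (ν + 1) i) < ε := fun ν _ =>
      (isPerronLimit_iff.1 (hφ (ν + 1)) i i).eventually (Metric.ball_mem_nhds _ hε)
    obtain ⟨W, hW⟩ := eventually_atTop.1 ((Filter.eventually_all_finset _).2 h1)
    refine ⟨W + p + 1, fun k hk => ?_⟩
    have hν : k % p < p := Nat.mod_lt _ h.1
    have h2 : φ (k + 1) = φ (k % p + 1) := by
      rw [← perron_eq_of_modEq h hφ (k % p + 1) (k / p)]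
      congr 1
      have := Nat.mod_add_div k p
      rw [mul_comm] at this
      omega
    rw [dist_zero_right, Real.norm_eq_abs, periodicEstimator, auxState_eq_stepProd hA.nonneg, h2,
      ← Real.dist_eq]
    exact hW (k - (k % p + 1)) (by omega) (k % p) (Finset.mem_range.2 hν)

end

/-! ### Convex analysis -/

section

variable {m m₁ m₂ n : ℕ}

/-- Hahn–Banach separates `(z, φ z)` from the open strict epigraph. The separating functional is
negative on the vertical direction, and dividing by that coefficient gives a subgradient. -/
theorem convexSubdiff_nonempty {φ : Euc m → ℝ} (hφ : ConvexOn ℝ Set.univ φ) (z : Euc m) :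
    (convexSubdiff φ z).Nonempty := by
  have hcont : Continuous φ := hφ.locallyLipschitz.continuous
  have hopen : IsOpen {p : Euc m × ℝ | p.1 ∈ Set.univ ∧ φ p.1 < p.2} := by
    simpa using isOpen_lt (hcont.comp continuous_fst) continuous_snd
  obtain ⟨ℓ, hℓ⟩ := geometric_hahn_banach_open_point hφ.convex_strict_epigraph hopen
    (x := (z, φ z)) (by simp)
  have hsplit : ∀ x t, ℓ (x, t) = ℓ (x, 0) + t * ℓ (0, 1) := by
    intro x t
    rw [← smul_eq_mul, ← map_smul, ← map_add]
    simp
  have hb : ℓ (0, 1) < 0 := by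
    have := hℓ (z, φ z + 1) (by simp)
    rw [hsplit z (φ z + 1), hsplit z (φ z)] at this
    linarith
  have hle : ∀ w, ℓ (w - z, 0) ≤ -ℓ (0, 1) * (φ w - φ z) := by
    intro w
    refine le_of_forall_pos_le_add fun ε hε => ?_
    have h1 := hℓ (w, φ w + ε / (-ℓ (0, 1)))
      (by simpa using div_pos hε (neg_pos.2 hb))
    rw [hsplit w, hsplit z] at h1
    have h2 : ℓ (w - z, 0) = ℓ (w, 0) - ℓ (z, 0) := by rw [← map_sub]; simp
    have h3 : ε / (-ℓ (0, 1)) * ℓ (0, 1) = -ε := by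
      have := hb.ne
      field_simp
    rw [h2]
    nlinarith
  refine ⟨(-ℓ (0, 1))⁻¹ • (InnerProductSpace.toDual ℝ (Euc m)).symm
    (ℓ.comp (ContinuousLinearMap.inl ℝ (Euc m) ℝ)), fun w => ?_⟩
  rw [inner_smul_right, real_inner_comm, InnerProductSpace.toDual_symm_apply]
  have h1 : (-ℓ (0, 1))⁻¹ * ℓ (w - z, 0) ≤ φ w - φ z := by
    rw [inv_mul_le_iff₀ (neg_pos.2 hb)]
    exact hle w
  simp only [ContinuousLinearMap.comp_apply, ContinuousLinearMap.inl_apply]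
  linarith

theorem abs_sub_le_of_subgradients_bounded {φ : Euc m → ℝ} (hφ : ConvexOn ℝ Set.univ φ) {K : Set (Euc m)}
    {L : ℝ} (hL : ∀ x ∈ K, ∀ q ∈ convexSubdiff φ x, ‖q‖ ≤ L) {x x' : Euc m} (hx : x ∈ K)
    (hx' : x' ∈ K) : |φ x - φ x'| ≤ L * ‖x - x'‖ := by
  have key : ∀ x ∈ K, ∀ x' ∈ K, φ x - φ x' ≤ L * ‖x - x'‖ := by
    intro x hx x' _
    obtain ⟨q, hq⟩ := convexSubdiff_nonempty hφ x
    have h1 := hq x'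
    have h2 := (neg_le_abs (inner ℝ (x' - x) q)).trans (abs_real_inner_le_norm _ _)
    have h3 := mul_le_mul_of_nonneg_left (hL x hx q hq) (norm_nonneg (x' - x))
    rw [norm_sub_rev x' x] at h2 h3
    linarith
  rw [abs_le]
  have := key x hx x' hx'
  have := key x' hx' x hx
  rw [norm_sub_rev] at this
  constructor <;> linarith

/-- The vectors `z - p` and `w - p` form an obtuse angle; expanding `‖z - w‖²` about `p` gives the
bound. -/
theorem IsProjection.norm_sub_le {K : Set (Euc m)} (hK : Convex ℝ K) {z p w : Euc m}
    (hp : IsProjection K z p) (hw : w ∈ K) : ‖p - w‖ ≤ ‖z - w‖ := by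
  have hne : Nonempty K := ⟨⟨w, hw⟩⟩
  have hbdd : BddBelow (Set.range fun w : K => ‖z - w‖) :=
    ⟨0, by rintro _ ⟨w, rfl⟩; exact norm_nonneg _⟩
  have h1 : ‖z - p‖ = ⨅ w : K, ‖z - w‖ :=
    le_antisymm (le_ciInf fun w => hp.2 w w.2) (ciInf_le hbdd ⟨p, hp.1⟩)
  have h2 := (norm_eq_iInf_iff_real_inner_le_zero hK hp.1).1 h1 w hw
  have h3 : ‖z - w‖ ^ 2 = ‖z - p‖ ^ 2 - 2 * inner ℝ (z - p) (w - p) + ‖p - w‖ ^ 2 := by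
    rw [show z - w = (z - p) - (w - p) by abel, norm_sub_sq_real, norm_sub_rev w p]
  refine le_of_sq_le_sq ?_ (norm_nonneg _)
  nlinarith [sq_nonneg ‖z - p‖]

/-- A nonempty convex set contains a relative ball around one of its points. -/
theorem exists_relative_ball {K : Set (Euc m)} (hK : Convex ℝ K) (hne : K.Nonempty) :
    ∃ y₀ ∈ K, ∃ r : ℝ, 0 < r ∧
      ∀ y ∈ K, ∀ y' ∈ K, ∀ c : ℝ, ‖c • (y' - y)‖ ≤ r → y₀ + c • (y' - y) ∈ K := by
  obtain ⟨y₀, hy₀⟩ := hne.intrinsicInterior hK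
  obtain ⟨⟨y₁, hy₁⟩, hy₁int, rfl⟩ := mem_intrinsicInterior.1 hy₀
  obtain ⟨r, hr, hball⟩ := Metric.mem_nhds_iff.1 (mem_interior_iff_mem_nhds.1 hy₁int)
  refine ⟨y₁, intrinsicInterior_subset hy₀, r / 2, half_pos hr, fun y hy y' hy' c hc => ?_⟩
  have hdir : c • (y' - y) ∈ (affineSpan ℝ K).direction :=
    Submodule.smul_mem _ _ (AffineSubspace.vsub_mem_direction (subset_affineSpan ℝ K hy')
      (subset_affineSpan ℝ K hy))
  have hmem : y₁ + c • (y' - y) ∈ affineSpan ℝ K := by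
    have := AffineSubspace.vadd_mem_of_mem_direction hdir hy₁
    rwa [vadd_eq_add, add_comm] at this
  have : (⟨y₁ + c • (y' - y), hmem⟩ : affineSpan ℝ K) ∈ Metric.ball (⟨y₁, hy₁⟩ : affineSpan ℝ K) r := by
    rw [Metric.mem_ball, Subtype.dist_eq, dist_eq_norm]
    simp only [add_sub_cancel_left]
    linarith
  exact hball this

theorem ConcaveOn.exists_growth_bound {φ : Euc m → ℝ} (hφ : ConcaveOn ℝ Set.univ φ) (y₀ : Euc m) (r : ℝ) :
    ∃ M : ℝ, 0 ≤ M ∧ (∀ w, ‖w - y₀‖ ≤ r → -M ≤ φ w) ∧ ∀ y, φ y ≤ M * (1 + ‖y - y₀‖) := by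
  have hcont : Continuous φ := hφ.locallyLipschitz.continuous
  obtain ⟨C, hC⟩ := (isCompact_closedBall y₀ r).exists_bound_of_continuousOn hcont.continuousOn
  obtain ⟨q, hq⟩ := convexSubdiff_nonempty (neg_convexOn_iff.2 hφ) y₀
  refine ⟨|C| + |φ y₀| + ‖q‖, by positivity, fun w hw => ?_, fun y => ?_⟩
  · have h1 := hC w (by rwa [mem_closedBall_iff_norm])
    rw [Real.norm_eq_abs] at h1
    have := neg_abs_le (φ w)
    have := le_abs_self C
    have := abs_nonneg (φ y₀)
    have := norm_nonneg q
    linarith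
  · have h1 := hq y
    have h2 := (neg_le_abs (inner ℝ (y - y₀) q)).trans (abs_real_inner_le_norm _ _)
    simp only [Pi.neg_apply] at h1
    have := le_abs_self (φ y₀)
    have := abs_nonneg C
    have := norm_nonneg (y - y₀)
    have := norm_nonneg q
    have : 0 ≤ (|C| + |φ y₀|) * ‖y - y₀‖ := by positivity
    nlinarith

/-- If `f i` is concave in the second argument and Lipschitz in the first, and the sum of the `f i`
is Lipschitz in the second, then each `f i` is Lipschitz in the second argument, with a constant of
linear growth. -/
theorem exists_lipschitz_linear_growth {X : Set (Euc m₁)} {Y : Set (Euc m₂)} (hX : X.Nonempty)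
    (hY : Y.Nonempty) (hYconv : Convex ℝ Y) {f : Fin n → Euc m₁ → Euc m₂ → ℝ}
    (hf : ∀ i x, ConcaveOn ℝ Set.univ (f i x)) {L L' : ℝ} (hL : 0 ≤ L) (hL' : 0 ≤ L')
    (hfx : ∀ i, ∀ x ∈ X, ∀ x' ∈ X, ∀ y ∈ Y, |f i x y - f i x' y| ≤ L * ‖x - x'‖)
    (hsum : ∀ x ∈ X, ∀ y ∈ Y, ∀ y' ∈ Y, |∑ i, f i x y - ∑ i, f i x y'| ≤ L' * ‖y - y'‖) :
    ∃ C : ℝ, 0 ≤ C ∧ ∀ i, ∀ x ∈ X, ∀ y ∈ Y, ∀ y' ∈ Y,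
      |f i x y - f i x y'| ≤ C * (1 + ‖x‖ + ‖y‖ + ‖y'‖) * ‖y - y'‖ := by
  obtain ⟨x₀, hx₀⟩ := hX
  obtain ⟨y₀, hy₀, r, hr, hball⟩ := exists_relative_ball hYconv hY
  choose M hM0 hMlow hMup using fun i => (hf i x₀).exists_growth_bound y₀ r
  set B := ∑ i, M i with hB
  have hB0 : 0 ≤ B := Finset.sum_nonneg fun i _ => hM0 i
  have hMB : ∀ i, M i ≤ B := fun i => Finset.single_le_sum (fun i _ => hM0 i) (Finset.mem_univ i)
  -- Bounds `f i` between `y` and any point near `y₀`, after moving from `x` to the fixed `x₀` by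
  -- the Lipschitz property in the first argument.
  set C₁ := 2 * B + B * ‖y₀‖ + 2 * L + 2 * L * ‖x₀‖ + B with hC₁
  have hC₁0 : 0 ≤ C₁ := by positivity
  have hQ : ∀ i, ∀ x ∈ X, ∀ y ∈ Y, ∀ w ∈ Y, ‖w - y₀‖ ≤ r →
      f i x y - f i x w ≤ C₁ * (1 + ‖x‖ + ‖y‖) := by
    intro i x hx y hy w hw hwr
    have h1 := (abs_le.1 (hfx i x hx x₀ hx₀ y hy)).2
    have h2 := (abs_le.1 (hfx i x hx x₀ hx₀ w hw)).1
    have h3 := hMlow i w hwr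
    have h4 := hMup i y
    have h5 : M i * (1 + ‖y - y₀‖) ≤ B * (1 + ‖y‖ + ‖y₀‖) := by
      have := norm_sub_le y y₀
      exact mul_le_mul (hMB i) (by linarith) (by positivity) hB0
    have h6 : L * ‖x - x₀‖ ≤ L * (‖x‖ + ‖x₀‖) := mul_le_mul_of_nonneg_left (norm_sub_le _ _) hL
    have h7 := hMB i
    have h8 : C₁ * (1 + ‖x‖ + ‖y‖) = (2 * B + B * ‖y₀‖ + B * ‖y‖ + 2 * L * ‖x₀‖ + 2 * L * ‖x‖) + (B +
      B * ‖x‖ * 3 + 2 * B * ‖y‖ + (B * ‖y₀‖ + 2 * L * ‖x₀‖) * (‖x‖ + ‖y‖) + 2 * L + 2 * L * ‖y‖) := by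
      rw [hC₁]; ring
    have h9 : 0 ≤ B + B * ‖x‖ * 3 + 2 * B * ‖y‖ + (B * ‖y₀‖ + 2 * L * ‖x₀‖) * (‖x‖ + ‖y‖)
      + 2 * L + 2 * L * ‖y‖ := by positivity
    rw [h8]
    nlinarith
  set C := ((1 + n) * C₁ + L' * (1 + ‖y₀‖)) / r with hC
  have hC0 : 0 ≤ C := by positivity
  have key : ∀ i, ∀ x ∈ X, ∀ y ∈ Y, ∀ y' ∈ Y,
      f i x y - f i x y' ≤ C * (1 + ‖x‖ + ‖y‖ + ‖y'‖) * ‖y - y'‖ := by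
    intro i x hx y hy y' hy'
    rcases eq_or_ne y y' with rfl | hne
    · simp
    set ε := ‖y' - y‖ with hε
    have hε0 : 0 < ε := norm_pos_iff.2 (sub_ne_zero.2 hne.symm)
    set t := ε / (r + ε) with ht
    have hre : 0 < r + ε := by positivity
    have ht0 : 0 ≤ t := by positivity
    have ht1 : 0 ≤ 1 - t := by
      rw [ht, sub_nonneg, div_le_one hre]; linarith
    have htr : t ≤ ε / r := by
      rw [ht]; gcongr; linarith
    set w := y₀ + (r / ε) • (y' - y) with hw
    have hwn : ‖(r / ε) • (y' - y)‖ ≤ r := by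
      rw [norm_smul, Real.norm_of_nonneg (by positivity), ← hε, div_mul_cancel₀ _ hε0.ne']
    have hwY : w ∈ Y := hball y hy y' hy' _ hwn
    -- The choice of `t` places `v` on two segments at once: from `y'` to `y₀` and from `y` to `w`.
    -- Concavity on the second bounds `f i x y - f i x v`; concavity on the first bounds `f l x y' -
    -- f l x v` for every `l`.
    set v := (1 - t) • y' + t • y₀ with hv
    have hvY : v ∈ Y := hYconv hy' hy₀ ht1 ht0 (by ring)
    have hvw : v = (1 - t) • y + t • w := by
      have : t * (r / ε) = 1 - t := by rw [ht]; field_simp; ring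
      rw [hv, hw, smul_add, smul_smul, this, smul_sub]
      abel
    have h1 : f i x y - f i x v ≤ t * (C₁ * (1 + ‖x‖ + ‖y‖)) := by
      have h := (hf i x).2 (Set.mem_univ y) (Set.mem_univ w) ht1 ht0 (by ring)
      rw [← hvw, smul_eq_mul, smul_eq_mul] at h
      have h' := mul_le_mul_of_nonneg_left
        (hQ i x hx y hy w hwY (by rwa [hw, add_sub_cancel_left])) ht0
      linarith
    have h2 : ∀ l, f l x y' - f l x v ≤ t * (C₁ * (1 + ‖x‖ + ‖y'‖)) := by
      intro l
      have h := (hf l x).2 (Set.mem_univ y') (Set.mem_univ y₀) ht1 ht0 (by ring)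
      rw [← hv, smul_eq_mul, smul_eq_mul] at h
      have h' := mul_le_mul_of_nonneg_left
        (hQ l x hx y' hy' y₀ hy₀ (by simpa using hr.le)) ht0
      linarith
    have h3 : ∑ l, f l x v - ∑ l, f l x y' ≤ t * (L' * (‖y'‖ + ‖y₀‖)) := by
      have h := (abs_le.1 (hsum x hx v hvY y' hy')).2
      have : v - y' = t • (y₀ - y') := by rw [hv, sub_smul, one_smul, smul_sub]; abel
      rw [this, norm_smul, Real.norm_of_nonneg ht0] at h
      have h' := mul_le_mul_of_nonneg_left (norm_sub_le y₀ y') (mul_nonneg hL' ht0)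
      nlinarith
    -- The direction that concavity does not control: the sum is Lipschitz, and the other summands
    -- cannot fall by more than `h2` allows.
    have h4 : f i x v - f i x y' ≤ t * (L' * (‖y'‖ + ‖y₀‖)) + n * (t * (C₁ * (1 + ‖x‖ + ‖y'‖))) := by
      have h5 : ∑ l, (f l x y' - f l x v + t * (C₁ * (1 + ‖x‖ + ‖y'‖)) * (-1)) ≤
          f i x y' - f i x v + t * (C₁ * (1 + ‖x‖ + ‖y'‖)) * (-1) := by
        rw [← Finset.add_sum_erase _ _ (Finset.mem_univ i)]
        have : ∑ l ∈ Finset.univ.erase i, (f l x y' - f l x v +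
            t * (C₁ * (1 + ‖x‖ + ‖y'‖)) * (-1)) ≤ 0 :=
          Finset.sum_nonpos fun l _ => by linarith [h2 l]
        linarith
      rw [Finset.sum_add_distrib, Finset.sum_sub_distrib] at h5
      simp only [Finset.sum_const, Finset.card_univ, Fintype.card_fin, nsmul_eq_mul] at h5
      have : 0 ≤ t * (C₁ * (1 + ‖x‖ + ‖y'‖)) := by positivity
      linarith
    have h6 : f i x y - f i x y' ≤
        t * (((1 + n) * C₁ + L' * (1 + ‖y₀‖)) * (1 + ‖x‖ + ‖y‖ + ‖y'‖)) := by
      have e1 : C₁ * (1 + ‖x‖ + ‖y‖) ≤ C₁ * (1 + ‖x‖ + ‖y‖ + ‖y'‖) :=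
        mul_le_mul_of_nonneg_left (by linarith [norm_nonneg y']) hC₁0
      have e2 : C₁ * (1 + ‖x‖ + ‖y'‖) ≤ C₁ * (1 + ‖x‖ + ‖y‖ + ‖y'‖) :=
        mul_le_mul_of_nonneg_left (by linarith [norm_nonneg y]) hC₁0
      have e3 : L' * (‖y'‖ + ‖y₀‖) ≤ L' * ((1 + ‖y₀‖) * (1 + ‖x‖ + ‖y‖ + ‖y'‖)) := by
        refine mul_le_mul_of_nonneg_left ?_ hL'
        have : 0 ≤ ‖y₀‖ * (‖x‖ + ‖y‖ + ‖y'‖) := by positivity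
        nlinarith [norm_nonneg x, norm_nonneg y]
      have e2' := mul_le_mul_of_nonneg_left e2 (Nat.cast_nonneg (α := ℝ) n)
      have : t * (C₁ * (1 + ‖x‖ + ‖y‖)) + (t * (L' * (‖y'‖ + ‖y₀‖)) +
          n * (t * (C₁ * (1 + ‖x‖ + ‖y'‖)))) =
          t * (C₁ * (1 + ‖x‖ + ‖y‖) + L' * (‖y'‖ + ‖y₀‖) + n * (C₁ * (1 + ‖x‖ + ‖y'‖))) := by ring
      refine (by linarith : f i x y - f i x y' ≤ t * (C₁ * (1 + ‖x‖ + ‖y‖) + L' * (‖y'‖ + ‖y₀‖) +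
        n * (C₁ * (1 + ‖x‖ + ‖y'‖)))).trans (mul_le_mul_of_nonneg_left ?_ ht0)
      linarith
    refine h6.trans ((mul_le_mul_of_nonneg_right htr (by positivity)).trans_eq ?_)
    rw [norm_sub_rev y y', ← hε, hC]
    ring
  refine ⟨C, hC0, fun i x hx y hy y' hy' => abs_le.2 ⟨?_, key i x hx y hy y' hy'⟩⟩
  have := key i x hx y' hy' y hy
  rw [norm_sub_rev, add_right_comm] at this
  linarith

/-- A strictly convex function grows at least linearly away from its minimizer. -/
theorem StrictConvexOn.exists_linear_growth {X : Set (Euc m)} (hX : IsClosed X) {φ : Euc m → ℝ}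
    (hφ : ConvexOn ℝ Set.univ φ) (hs : StrictConvexOn ℝ X φ) {xs : Euc m} (hxs : xs ∈ X)
    (hmin : ∀ x ∈ X, φ xs ≤ φ x) {δ : ℝ} (hδ : 0 < δ) :
    ∃ c : ℝ, 0 < c ∧ ∀ x ∈ X, δ ≤ ‖x - xs‖ → c * ‖x - xs‖ ≤ φ x - φ xs := by
  have hcont : Continuous φ := hφ.locallyLipschitz.continuous
  have hcomp : IsCompact (X ∩ Metric.sphere xs δ) := (isCompact_sphere xs δ).inter_left hX
  have hpos : ∀ x ∈ X, x ≠ xs → φ xs < φ x := by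
    intro x hx hne
    have h1 := hs.2 hxs hx hne.symm (by norm_num : (0 : ℝ) < 1 / 2) (by norm_num : (0 : ℝ) < 1 / 2)
      (by norm_num)
    have h2 := hmin _ (hs.1 hxs hx (by norm_num : (0 : ℝ) ≤ 1 / 2) (by norm_num : (0 : ℝ) ≤ 1 / 2)
      (by norm_num))
    simp only [smul_eq_mul] at h1
    linarith
  -- The minimum over the compact slice at distance `δ`; convexity along rays from `xs` spreads the
  -- slope `μ / δ` to all greater distances.
  obtain ⟨μ, hμ, hμle⟩ : ∃ μ : ℝ, 0 < μ ∧ ∀ x ∈ X ∩ Metric.sphere xs δ, μ ≤ φ x - φ xs := by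
    rcases (X ∩ Metric.sphere xs δ).eq_empty_or_nonempty with h | h
    · exact ⟨1, one_pos, by simp [h]⟩
    · obtain ⟨x, hx, hxmin⟩ := hcomp.exists_isMinOn h hcont.continuousOn
      refine ⟨φ x - φ xs, sub_pos.2 (hpos x hx.1 ?_), fun y hy => by linarith [hxmin hy, show φ x ≤ φ y from hxmin hy]⟩
      rintro rfl
      simp [hδ.ne] at hx
  refine ⟨μ / δ, div_pos hμ hδ, fun x hx hxδ => ?_⟩
  have hd : 0 < ‖x - xs‖ := hδ.trans_le hxδ
  set t := δ / ‖x - xs‖ with ht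
  have ht0 : 0 ≤ t := by positivity
  have ht1 : 0 ≤ 1 - t := sub_nonneg.2 ((div_le_one hd).2 hxδ)
  have hmem : (1 - t) • xs + t • x ∈ X ∩ Metric.sphere xs δ := by
    refine ⟨hs.1 hxs hx ht1 ht0 (by ring), ?_⟩
    have : (1 - t) • xs + t • x - xs = t • (x - xs) := by rw [sub_smul, one_smul, smul_sub]; abel
    rw [mem_sphere_iff_norm, this, norm_smul, Real.norm_of_nonneg ht0, ht, div_mul_cancel₀ _ hd.ne']
  have h1 := hμle _ hmem
  have h2 := hφ.2 (Set.mem_univ xs) (Set.mem_univ x) ht1 ht0 (by ring)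
  simp only [smul_eq_mul] at h2
  have h3 : μ ≤ t * (φ x - φ xs) := by linarith
  calc μ / δ * ‖x - xs‖ ≤ t * (φ x - φ xs) / δ * ‖x - xs‖ := by gcongr
    _ = φ x - φ xs := by rw [ht]; field_simp

end

/-! ### The dynamics of one subnetwork -/

/-- The projected subgradient dynamics of one subnetwork, with stepsizes `γ k / est k i`, where
`xb k i` is the information of agent `i` on the other subnetwork. -/
structure IsSubgradientDynamics {n m₁ m₂ : ℕ} (X : Set (Euc m₁)) (Y : Set (Euc m₂))
    (f : Fin n → Euc m₁ → Euc m₂ → ℝ) (A : ℕ → Matrix (Fin n) (Fin n) ℝ) (η : ℝ)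
    (φ est : ℕ → Fin n → ℝ) (γ : ℕ → ℝ) (L : ℝ) (x : ℕ → Fin n → Euc m₁)
    (xb : ℕ → Fin n → Euc m₂) (q : ℕ → Fin n → Euc m₁) : Prop where
  card_pos : 0 < n
  weights : ConsensusWeights A η
  convex_X : Convex ℝ X
  convex_f : ∀ i y, ConvexOn ℝ Set.univ fun x => f i x y
  perron : ∀ s, IsPerronLimit A s (φ s)
  est_pos : ∀ k i, 0 < est k i
  est_lim : ∀ i, Tendsto (fun k => est k i - φ (k + 1) i) atTop (𝓝 0)
  step_nonneg : ∀ k, 0 ≤ γ k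
  step_lim : Tendsto γ atTop (𝓝 0)
  L_nonneg : 0 ≤ L
  bound : ∀ i, ∀ x ∈ X, ∀ y ∈ Y, ∀ q ∈ convexSubdiff (fun x' => f i x' y) x, ‖q‖ ≤ L
  -- Only eventually: the information is arbitrary before the first contact, and initial states need
  -- not lie in the constraint set.
  mem_Y : ∀ᶠ k in atTop, ∀ i, xb k i ∈ Y
  subgrad : ∀ k i, q k i ∈ convexSubdiff (fun x' => f i x' (xb k i)) (∑ j, A k i j • x k j)
  proj : ∀ k i, IsProjection X (∑ j, A k i j • x k j - (1 / est k i * γ k) • q k i) (x (k + 1) i)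

namespace IsSubgradientDynamics

variable {n m₁ m₂ : ℕ} {X : Set (Euc m₁)} {Y : Set (Euc m₂)}
  {f : Fin n → Euc m₁ → Euc m₂ → ℝ} {A : ℕ → Matrix (Fin n) (Fin n) ℝ} {η : ℝ}
  {φ est : ℕ → Fin n → ℝ} {γ : ℕ → ℝ} {L : ℝ} {x : ℕ → Fin n → Euc m₁}
  {xb : ℕ → Fin n → Euc m₂} {q : ℕ → Fin n → Euc m₁}

theorem exists_inv_est_le
    (D : IsSubgradientDynamics X Y f A η φ est γ L x xb q)
    : ∃ c : ℝ, 0 < c ∧ ∀ᶠ k in atTop, ∀ i, 1 / est k i ≤ c := by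
  obtain ⟨c, hc, hφ⟩ := exists_perron_lower D.weights
  refine ⟨1 / (c / 2), by positivity, ?_⟩
  rw [eventually_all]
  intro i
  filter_upwards [(D.est_lim i).eventually (lt_mem_nhds (show -(c / 2) < 0 by linarith))] with k hk
  exact one_div_le_one_div_of_le (by positivity) (by linarith [hφ _ _ (D.perron (k + 1)) i])

theorem perron_nonneg
    (D : IsSubgradientDynamics X Y f A η φ est γ L x xb q) (k : ℕ) (i : Fin n) : 0 ≤ φ k i := by
  obtain ⟨c, hc, hφ⟩ := exists_perron_lower D.weights
  exact hc.le.trans (hφ _ _ (D.perron k) i)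

theorem perron_le_one
    (D : IsSubgradientDynamics X Y f A η φ est γ L x xb q) (k : ℕ) (i : Fin n) : φ k i ≤ 1 := by
  rw [← (D.perron k).sum_eq_one D.weights D.card_pos]
  exact Finset.single_le_sum (fun j _ => D.perron_nonneg k j) (Finset.mem_univ i)

theorem tendsto_perron_div_est
    (D : IsSubgradientDynamics X Y f A η φ est γ L x xb q) (i : Fin n) :
    Tendsto (fun k => φ (k + 1) i * (1 / est k i) - 1) atTop (𝓝 0) := by
  obtain ⟨c, hc, hle⟩ := D.exists_inv_est_le
  refine squeeze_zero_norm' (a := fun k => |est k i - φ (k + 1) i| * c) ?_ ?_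
  · filter_upwards [hle] with k hk
    have h0 := D.est_pos k i
    have h1 : φ (k + 1) i * (1 / est k i) - 1 = -(est k i - φ (k + 1) i) * (1 / est k i) := by
      field_simp
      ring
    rw [h1, Real.norm_eq_abs, abs_mul, abs_neg, abs_of_nonneg (by positivity : 0 ≤ 1 / est k i)]
    exact mul_le_mul_of_nonneg_left (hk i) (abs_nonneg _)
  · simpa using (D.est_lim i).abs.mul_const c

theorem mem_X
    (D : IsSubgradientDynamics X Y f A η φ est γ L x xb q)
    {k : ℕ} (hk : 1 ≤ k) (i : Fin n) : x k i ∈ X := by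
  obtain ⟨k, rfl⟩ := Nat.exists_eq_add_of_le' hk
  exact (D.proj k i).1

theorem average_mem
    (D : IsSubgradientDynamics X Y f A η φ est γ L x xb q)
    {k : ℕ} (hk : 1 ≤ k) (i : Fin n) : ∑ j, A k i j • x k j ∈ X :=
  D.convex_X.sum_mem (fun j _ => D.weights.nonneg k i j) (D.weights.row_sum k i)
    fun j _ => D.mem_X hk j

theorem eventually_norm_subgrad_le
    (D : IsSubgradientDynamics X Y f A η φ est γ L x xb q) : ∀ᶠ k in atTop, ∀ i, ‖q k i‖ ≤ L := by
  filter_upwards [D.mem_Y, eventually_ge_atTop 1] with k hk hk1 i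
  exact D.bound i _ (D.average_mem hk1 i) _ (hk i) _ (D.subgrad k i)

/-- The average already lies in `X`, so projecting moves the state away from it by at most the step
length. -/
theorem tendsto_disturbance
    (D : IsSubgradientDynamics X Y f A η φ est γ L x xb q) (i : Fin n) :
    Tendsto (fun k => x (k + 1) i - ∑ j, A k i j • x k j) atTop (𝓝 0) := by
  obtain ⟨c, hc, hle⟩ := D.exists_inv_est_le
  refine squeeze_zero_norm' (a := fun k => c * γ k * L) ?_ ?_
  · filter_upwards [hle, D.eventually_norm_subgrad_le, eventually_ge_atTop 1] with k hk hq hk1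
    refine ((D.proj k i).norm_sub_le D.convex_X (D.average_mem hk1 i)).trans ?_
    rw [sub_sub_cancel_left, norm_neg, norm_smul, Real.norm_of_nonneg
      (mul_nonneg (one_div_nonneg.2 (D.est_pos k i).le) (D.step_nonneg k))]
    exact mul_le_mul (mul_le_mul_of_nonneg_right (hk i) (D.step_nonneg k)) (hq i) (norm_nonneg _)
      (mul_nonneg hc.le (D.step_nonneg k))
  · simpa using (D.step_lim.const_mul c).mul_const L

theorem tendsto_sub
    (D : IsSubgradientDynamics X Y f A η φ est γ L x xb q)
    (i j : Fin n) : Tendsto (fun k => x k i - x k j) atTop (𝓝 0) :=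
  tendsto_sub_of_consensus D.weights (e := fun k i => x (k + 1) i - ∑ j, A k i j • x k j)
    (fun k i => by simp) D.tendsto_disturbance i j

theorem average_sub
    (D : IsSubgradientDynamics X Y f A η φ est γ L x xb q) (k : ℕ) (i : Fin n) (z : Euc m₁) :
    ∑ l, A k i l • x k l - z = ∑ l, A k i l • (x k l - z) := by
  simp only [smul_sub, Finset.sum_sub_distrib, ← Finset.sum_smul, D.weights.row_sum, one_smul]

theorem tendsto_average_sub
    (D : IsSubgradientDynamics X Y f A η φ est γ L x xb q) (i j : Fin n) :
    Tendsto (fun k => ∑ l, A k i l • x k l - x k j) atTop (𝓝 0) := by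
  refine squeeze_zero_norm (a := fun k => ∑ l, ‖x k l - x k j‖) (fun k => ?_) ?_
  · rw [D.average_sub]
    refine (norm_sum_le _ _).trans (Finset.sum_le_sum fun l _ => ?_)
    rw [norm_smul, Real.norm_of_nonneg (D.weights.nonneg k i l)]
    refine mul_le_of_le_one_left (norm_nonneg _) ?_
    rw [← D.weights.row_sum k i]
    exact Finset.single_le_sum (fun l _ => D.weights.nonneg k i l) (Finset.mem_univ l)
  · simpa using tendsto_finsetSum Finset.univ fun l _ => (D.tendsto_sub l j).norm

theorem tendsto_add_sub
    (D : IsSubgradientDynamics X Y f A η φ est γ L x xb q) (d : ℕ) (i j : Fin n) :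
    Tendsto (fun k => x (k + d) i - x k j) atTop (𝓝 0) := by
  induction d generalizing i with
  | zero => exact D.tendsto_sub i j
  | succ d ih =>
    have h1 : Tendsto (fun k => x (k + 1) i - x k i) atTop (𝓝 0) := by
      simpa using (D.tendsto_disturbance i).add (D.tendsto_average_sub i i)
    have h2 := ((tendsto_add_atTop_iff_nat d).2 h1).add (ih i)
    simpa [add_assoc] using h2

theorem abs_sub_le
    (D : IsSubgradientDynamics X Y f A η φ est γ L x xb q)
    (i : Fin n) {u u' : Euc m₁} (hu : u ∈ X) (hu' : u' ∈ X) {y : Euc m₂}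
    (hy : y ∈ Y) : |f i u y - f i u' y| ≤ L * ‖u - u'‖ :=
  abs_sub_le_of_subgradients_bounded (D.convex_f i y) (fun x hx => D.bound i x hx y hy) hu hu'

/-- Averaging does not increase the weighted squared distance to a point. -/
theorem sum_average_le
    (D : IsSubgradientDynamics X Y f A η φ est γ L x xb q) (k : ℕ) (z : Euc m₁) :
    ∑ i, φ (k + 1) i * ‖∑ j, A k i j • x k j - z‖ ^ 2 ≤ ∑ j, φ k j * ‖x k j - z‖ ^ 2 := by
  have hconv : ConvexOn ℝ Set.univ ((norm : Euc m₁ → ℝ) ^ 2) :=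
    convexOn_univ_norm.pow (fun _ _ => norm_nonneg _) 2
  calc ∑ i, φ (k + 1) i * ‖∑ j, A k i j • x k j - z‖ ^ 2
      ≤ ∑ i, φ (k + 1) i * ∑ j, A k i j * ‖x k j - z‖ ^ 2 := by
        refine Finset.sum_le_sum fun i _ => mul_le_mul_of_nonneg_left ?_ (D.perron_nonneg _ _)
        rw [D.average_sub]
        exact hconv.map_sum_le (fun j _ => D.weights.nonneg k i j) (D.weights.row_sum k i)
          (fun j _ => Set.mem_univ _)
    _ = ∑ j, φ k j * ‖x k j - z‖ ^ 2 := by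
        simp only [Finset.mul_sum]
        rw [Finset.sum_comm]
        refine Finset.sum_congr rfl fun j _ => ?_
        -- The relation `φ(k)' = φ(k+1)' A(k)` turns the weights at time `k + 1` into those at time
        -- `k`.
        rw [(D.perron k).vecMul (D.perron (k + 1)) j, Finset.sum_mul]
        exact Finset.sum_congr rfl fun i _ => by ring

/-- The one-step estimate of a single agent. -/
theorem agent_step_le
    (D : IsSubgradientDynamics X Y f A η φ est γ L x xb q) {c : ℝ} (hc : 0 < c) {C : ℝ} (hC : 0 ≤ C)
    (hfy : ∀ i, ∀ x ∈ X, ∀ y ∈ Y, ∀ y' ∈ Y,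
      |f i x y - f i x y'| ≤ C * (1 + ‖x‖ + ‖y‖ + ‖y'‖) * ‖y - y'‖)
    {xs : Euc m₁} (hxs : xs ∈ X) {k : ℕ} (hk1 : 1 ≤ k) {i : Fin n} {u : Euc m₁} {v : Euc m₂}
    (hu : u ∈ X) (hv : v ∈ Y) (hb : xb k i ∈ Y) (hinv : 1 / est k i ≤ c)
    (hxu : ‖∑ j, A k i j • x k j - u‖ ≤ 1) (hbv : ‖xb k i - v‖ ≤ 1) :
    φ (k + 1) i * ‖x (k + 1) i - xs‖ ^ 2 ≤
      φ (k + 1) i * ‖∑ j, A k i j • x k j - xs‖ ^ 2 - 2 * γ k * (f i u v - f i xs v -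
        (|φ (k + 1) i * (1 / est k i) - 1| * (L * (2 + ‖xs‖)) +
          L * ‖∑ j, A k i j • x k j - u‖ + C * (4 + ‖xs‖) * ‖xb k i - v‖ +
          γ k * (c * L) ^ 2) * (1 + ‖u‖ + ‖v‖)) := by
  set xh := ∑ j, A k i j • x k j with hxh
  set w := φ (k + 1) i with hw
  set a := 1 / est k i with ha
  set S := 1 + ‖u‖ + ‖v‖ with hS
  have hS1 : 1 ≤ S := by rw [hS]; linarith [norm_nonneg u, norm_nonneg v]
  have ha0 : 0 ≤ a := one_div_nonneg.2 (D.est_pos k i).le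
  have hγ0 := D.step_nonneg k
  have hL0 := D.L_nonneg
  have hw0 : 0 ≤ w := D.perron_nonneg _ _
  have hw1 : w ≤ 1 := D.perron_le_one _ _
  have hxhX : xh ∈ X := D.average_mem hk1 i
  have hq : ‖q k i‖ ≤ L := D.bound i _ hxhX _ hb _ (D.subgrad k i)
  set Δ := f i xh (xb k i) - f i xs (xb k i) with hΔ
  -- Nonexpansiveness of the projection together with the subgradient inequality at `xs`.
  have h1 : ‖x (k + 1) i - xs‖ ^ 2 ≤ ‖xh - xs‖ ^ 2 - 2 * (a * γ k) * Δ + (γ k) ^ 2 * (c * L) ^ 2 := by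
    have h2 := (D.proj k i).norm_sub_le D.convex_X hxs
    rw [← hxh, ← ha, show xh - (a * γ k) • q k i - xs = (xh - xs) - (a * γ k) • q k i by abel] at h2
    have h3 := pow_le_pow_left₀ (norm_nonneg _) h2 2
    rw [norm_sub_sq_real (xh - xs), inner_smul_right, norm_smul, mul_pow, Real.norm_of_nonneg
      (mul_nonneg ha0 hγ0)] at h3
    have h4 := D.subgrad k i xs
    rw [← hxh, ← neg_sub xh xs, inner_neg_left] at h4
    have h5 : (a * γ k) * Δ ≤ (a * γ k) * inner ℝ (xh - xs) (q k i) :=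
      mul_le_mul_of_nonneg_left (by simp only [hΔ]; linarith) (mul_nonneg ha0 hγ0)
    have h6 : (a * γ k) ^ 2 * ‖q k i‖ ^ 2 ≤ (γ k) ^ 2 * (c * L) ^ 2 := by
      rw [← mul_pow, ← mul_pow]
      refine pow_le_pow_left₀ (by positivity) ?_ 2
      calc a * γ k * ‖q k i‖ ≤ c * γ k * L := by gcongr
        _ = γ k * (c * L) := by ring
    linarith
  have hxhn : ‖xh - xs‖ ≤ (2 + ‖xs‖) * S := by
    have e1 : ‖xh - xs‖ ≤ ‖xh - u‖ + ‖u‖ + ‖xs‖ := by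
      rw [show xh - xs = (xh - u) + u - xs by abel]
      exact (norm_sub_le _ _).trans (add_le_add_left (norm_add_le _ _) _)
    have e2 : ‖xs‖ ≤ ‖xs‖ * S := le_mul_of_one_le_right (norm_nonneg _) hS1
    have e3 : ‖u‖ ≤ S := by rw [hS]; linarith [norm_nonneg v]
    linarith
  have hbn : ‖xb k i‖ ≤ 1 + ‖v‖ := by
    have := norm_sub_norm_le (xb k i) v
    linarith
  -- The cost of replacing the weight `w * a` by its limit one.
  have hwa : Δ - |w * a - 1| * (L * (2 + ‖xs‖)) * S ≤ w * a * Δ := by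
    have e1 : |Δ| ≤ L * ((2 + ‖xs‖) * S) :=
      (D.abs_sub_le i hxhX hxs hb).trans (mul_le_mul_of_nonneg_left hxhn hL0)
    have e2 := (neg_abs_le ((w * a - 1) * Δ))
    rw [abs_mul] at e2
    have e3 := mul_le_mul_of_nonneg_left e1 (abs_nonneg (w * a - 1))
    linarith
  -- Replaces the agent's own points by the common `u`, `v`. The second argument moves at both `u`
  -- and `xs`, with constants `2` and `2 + ‖xs‖`, hence `4 + ‖xs‖`.
  have hΔlow : f i u v - f i xs v - (L * ‖xh - u‖ + C * (4 + ‖xs‖) * ‖xb k i - v‖) * S ≤ Δ := by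
    have e1 := (abs_le.1 (D.abs_sub_le i hxhX hu hb)).1
    have e2 := (abs_le.1 (hfy i u hu _ hb _ hv)).1
    have e3 := (abs_le.1 (hfy i xs hxs _ hb _ hv)).2
    have e4 : C * (1 + ‖u‖ + ‖xb k i‖ + ‖v‖) * ‖xb k i - v‖ ≤ C * (2 * S) * ‖xb k i - v‖ := by
      gcongr; rw [hS]; linarith [norm_nonneg u]
    have e5 : C * (1 + ‖xs‖ + ‖xb k i‖ + ‖v‖) * ‖xb k i - v‖ ≤
        C * ((2 + ‖xs‖) * S) * ‖xb k i - v‖ := by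
      gcongr
      have : ‖xs‖ ≤ ‖xs‖ * S := le_mul_of_one_le_right (norm_nonneg _) hS1
      have : 2 * (1 + ‖v‖) ≤ 2 * S := by rw [hS]; linarith [norm_nonneg u]
      linarith
    have e6 : L * ‖xh - u‖ ≤ L * ‖xh - u‖ * S := le_mul_of_one_le_right (by positivity) hS1
    simp only [hΔ]
    linarith
  have hfin : w * ‖x (k + 1) i - xs‖ ^ 2 ≤
      w * ‖xh - xs‖ ^ 2 - 2 * γ k * (w * a * Δ - γ k * (c * L) ^ 2 * S) := by
    have e1 := mul_le_mul_of_nonneg_left h1 hw0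
    have e2 : w * ((γ k) ^ 2 * (c * L) ^ 2) ≤ 2 * γ k * (γ k * (c * L) ^ 2 * S) := by
      have e3 : 0 ≤ (γ k) ^ 2 * (c * L) ^ 2 := by positivity
      have e4 : w ≤ 2 * S := by linarith
      have := mul_le_mul_of_nonneg_right e4 e3
      linarith
    linarith
  refine hfin.trans (sub_le_sub_left (mul_le_mul_of_nonneg_left ?_ (by positivity)) _)
  linarith

/-- The one-step estimate of the subnetwork. -/
theorem exists_drift
    (D : IsSubgradientDynamics X Y f A η φ est γ L x xb q) {C : ℝ} (hC : 0 ≤ C)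
    (hfy : ∀ i, ∀ x ∈ X, ∀ y ∈ Y, ∀ y' ∈ Y,
      |f i x y - f i x y'| ≤ C * (1 + ‖x‖ + ‖y‖ + ‖y'‖) * ‖y - y'‖)
    {xs : Euc m₁} (hxs : xs ∈ X) (i₀ : Fin n) {v : ℕ → Euc m₂} (hv : ∀ᶠ k in atTop, v k ∈ Y)
    (hbv : ∀ i, Tendsto (fun k => xb k i - v k) atTop (𝓝 0)) :
    ∃ ε : ℕ → ℝ, Tendsto ε atTop (𝓝 0) ∧ ∀ᶠ k in atTop,
      ∑ i, φ (k + 1) i * ‖x (k + 1) i - xs‖ ^ 2 ≤ ∑ i, φ k i * ‖x k i - xs‖ ^ 2 -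
        2 * γ k * (sumObjective f (x k i₀) (v k) - sumObjective f xs (v k) -
          ε k * (1 + ‖x k i₀‖ + ‖v k‖)) := by
  obtain ⟨c, hc, hinv⟩ := D.exists_inv_est_le
  set e : Fin n → ℕ → ℝ := fun i k => |φ (k + 1) i * (1 / est k i) - 1| * (L * (2 + ‖xs‖)) +
    L * ‖∑ j, A k i j • x k j - x k i₀‖ + C * (4 + ‖xs‖) * ‖xb k i - v k‖ +
    γ k * (c * L) ^ 2 with he
  have hxlim := fun i => (D.tendsto_average_sub i i₀).norm
  have hblim := fun i => (hbv i).norm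
  simp only [norm_zero] at hxlim hblim
  refine ⟨fun k => ∑ i, e i k, ?_, ?_⟩
  · have h1 : ∀ i, Tendsto (e i) atTop (𝓝 0) := fun i => by
      have := ((((D.tendsto_perron_div_est i).abs.mul_const (L * (2 + ‖xs‖))).add
        ((hxlim i).const_mul L)).add ((hblim i).const_mul (C * (4 + ‖xs‖)))).add
        (D.step_lim.mul_const ((c * L) ^ 2))
      simpa [he] using this
    simpa using tendsto_finsetSum Finset.univ fun i _ => h1 i
  · have h1 : ∀ᶠ k in atTop, ∀ i, ‖∑ j, A k i j • x k j - x k i₀‖ ≤ 1 :=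
      eventually_all.2 fun i => (hxlim i).eventually (ge_mem_nhds one_pos)
    have h2 : ∀ᶠ k in atTop, ∀ i, ‖xb k i - v k‖ ≤ 1 :=
      eventually_all.2 fun i => (hblim i).eventually (ge_mem_nhds one_pos)
    filter_upwards [h1, h2, hv, hinv, D.mem_Y, eventually_ge_atTop 1] with k h1 h2 hv hinv hY hk
    have h3 := Finset.sum_le_sum fun i (_ : i ∈ Finset.univ) =>
      D.agent_step_le hc hC hfy hxs hk (D.mem_X hk i₀) hv (hY i) (hinv i) (h1 i) (h2 i)
    refine h3.trans ?_
    rw [Finset.sum_sub_distrib, ← Finset.mul_sum, Finset.sum_sub_distrib, Finset.sum_sub_distrib,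
      ← Finset.sum_mul]
    exact sub_le_sub_right (D.sum_average_le k xs) _

/-- Since the Perron weights sum to one, the Lyapunov function is controlled by a single reference
agent and the vanishing spread. -/
theorem sum_le_sq
    (D : IsSubgradientDynamics X Y f A η φ est γ L x xb q) (k : ℕ) (i₀ : Fin n) (xs : Euc m₁) :
    ∑ i, φ k i * ‖x k i - xs‖ ^ 2 ≤ (‖x k i₀ - xs‖ + ∑ i, ‖x k i - x k i₀‖) ^ 2 := by
  calc ∑ i, φ k i * ‖x k i - xs‖ ^ 2
      ≤ ∑ i, φ k i * (‖x k i₀ - xs‖ + ∑ i, ‖x k i - x k i₀‖) ^ 2 := by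
        refine Finset.sum_le_sum fun i _ => mul_le_mul_of_nonneg_left ?_ (D.perron_nonneg k i)
        refine pow_le_pow_left₀ (norm_nonneg _) ?_ 2
        have h1 := Finset.single_le_sum (f := fun i => ‖x k i - x k i₀‖)
          (fun i _ => norm_nonneg _) (Finset.mem_univ i)
        have h2 := norm_add_le (x k i - x k i₀) (x k i₀ - xs)
        rw [sub_add_sub_cancel] at h2
        linarith
    _ = _ := by rw [← Finset.sum_mul, (D.perron k).sum_eq_one D.weights D.card_pos, one_mul]

end IsSubgradientDynamics

/-! ### Delayed information -/

section

variable {n m d : ℕ} {B : ℕ → Matrix (Fin n) (Fin m) ℝ}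

theorem exists_isLastContact {T : ℕ}
    (hB : ∀ k i, ∃ s, k ≤ s ∧ s < k + T ∧ (neighbors (B s) i).Nonempty) {k : ℕ} (hk : T ≤ k)
    (i : Fin n) : ∃ s, IsLastContact B i k s ∧ k < s + T := by
  -- The window that ends exactly at time `k`.
  obtain ⟨t, ht1, ht2, ht3⟩ := hB (k + 1 - T) i
  have hfin : ({t | t ≤ k ∧ (neighbors (B t) i).Nonempty} : Set ℕ).Finite :=
    (Set.finite_Iic k).subset fun t ht => ht.1
  have hne : ({t | t ≤ k ∧ (neighbors (B t) i).Nonempty} : Set ℕ).Nonempty :=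
    ⟨t, by omega, ht3⟩
  obtain ⟨s, hs⟩ := hfin.exists_maximal hne
  have hgr : IsLastContact B i k s :=
    ⟨hs.1, fun u hu => (le_total u s).elim id fun h => hs.2 hu h⟩
  refine ⟨s, hgr, ?_⟩
  have : t ≤ s := hgr.2 ⟨by omega, ht3⟩
  omega

variable {xb : ℕ → Fin n → Euc d} {y : ℕ → Fin m → Euc d}

theorem eventually_received_mem
    (hnn : ∀ k i j, 0 ≤ B k i j)
    (hsum : ∀ s i, (neighbors (B s) i).Nonempty → ∑ j ∈ neighbors (B s) i, B s i j = 1)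
    (hcontact : ∃ T : ℕ, ∀ k i, ∃ s, k ≤ s ∧ s < k + T ∧ (neighbors (B s) i).Nonempty)
    (hxb : ∀ k i s, IsLastContact B i k s → xb k i = neighborAverage (B s) (y s) i)
    {K : Set (Euc d)} (hK : Convex ℝ K)
    (hy : ∀ k i, y (k + 1) i ∈ K) : ∀ᶠ k in atTop, ∀ i, xb k i ∈ K := by
  obtain ⟨T, hT⟩ := hcontact
  filter_upwards [eventually_ge_atTop (T + 1)] with k hk i
  obtain ⟨s, hs, hks⟩ := exists_isLastContact hT (by omega : T ≤ k) i
  rw [hxb k i s hs]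
  -- The contact must not be at time `0`, when states may lie outside `K`; this is why `k` starts at
  -- `T + 1`.
  obtain ⟨s, rfl⟩ : ∃ t, s = t + 1 := ⟨s - 1, by omega⟩
  exact hK.sum_mem (fun j _ => hnn _ _ _) (hsum _ i hs.1.2) fun j _ => hy s j

theorem tendsto_received_sub
    (hnn : ∀ k i j, 0 ≤ B k i j)
    (hsum : ∀ s i, (neighbors (B s) i).Nonempty → ∑ j ∈ neighbors (B s) i, B s i j = 1)
    (hcontact : ∃ T : ℕ, ∀ k i, ∃ s, k ≤ s ∧ s < k + T ∧ (neighbors (B s) i).Nonempty)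
    (hxb : ∀ k i s, IsLastContact B i k s → xb k i = neighborAverage (B s) (y s) i)
    (hy : ∀ d i j, Tendsto (fun k => y (k + d) i - y k j) atTop (𝓝 0))
    (i : Fin n) (j₀ : Fin m) : Tendsto (fun k => xb k i - y k j₀) atTop (𝓝 0) := by
  obtain ⟨T, hT⟩ := hcontact
  rw [Metric.tendsto_atTop]
  intro ε hε
  -- Delays are less than `T`, so uniformity over finitely many shifts `d` suffices.
  have h1 : ∀ᶠ k in atTop, ∀ d ∈ Finset.range T, ∀ j, ‖y k j - y (k + d) j₀‖ < ε / 2 := by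
    refine (Filter.eventually_all_finset _).2 fun d _ => eventually_all.2 fun j => ?_
    have := (hy d j₀ j).norm
    rw [norm_zero] at this
    filter_upwards [this.eventually (gt_mem_nhds (half_pos hε))] with k hk
    rwa [norm_sub_rev]
  obtain ⟨K, hK⟩ := eventually_atTop.1 h1
  refine ⟨K + T, fun k hk => ?_⟩
  obtain ⟨s, hs, hks⟩ := exists_isLastContact hT (by omega : T ≤ k) i
  have hsk : s ≤ k := hs.1.1
  have h2 := hK s (by omega) (k - s) (Finset.mem_range.2 (by omega))
  rw [show s + (k - s) = k by omega] at h2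
  have h3 := hsum s i hs.1.2
  have h4 : xb k i - y k j₀ = ∑ j ∈ neighbors (B s) i, B s i j • (y s j - y k j₀) := by
    rw [hxb k i s hs, neighborAverage]
    simp only [smul_sub, Finset.sum_sub_distrib, ← Finset.sum_smul, h3, one_smul]
  rw [dist_zero_right, h4]
  calc ‖∑ j ∈ neighbors (B s) i, B s i j • (y s j - y k j₀)‖
      ≤ ∑ j ∈ neighbors (B s) i, B s i j * (ε / 2) := by
        refine (norm_sum_le _ _).trans (Finset.sum_le_sum fun j _ => ?_)
        rw [norm_smul, Real.norm_of_nonneg (hnn s i j)]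
        exact mul_le_mul_of_nonneg_left (h2 j).le (hnn s i j)
    _ = ε / 2 := by rw [← Finset.sum_mul, h3, one_mul]
    _ < ε := half_lt_self hε

end

/-! ### Convergence of the Lyapunov function -/

/-- As `∑ γ = ∞`, a constant rate of decrease above a level forces `V` below it at some late time.
From then on `V` can at most double that level in one step before it decreases again. -/
theorem tendsto_zero_of_drift {V γ : ℕ → ℝ} (hV : ∀ k, 0 ≤ V k)
    (hsum : Tendsto (fun k => ∑ s ∈ Finset.range k, γ s) atTop atTop) (hγ : ∀ k, 0 ≤ γ k)
    (hdrift : ∀ θ > 0, ∃ c > 0, ∀ᶠ k in atTop, θ ≤ V k → V (k + 1) ≤ V k - c * γ k)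
    (hjump : ∀ θ > 0, ∀ᶠ k in atTop, V k < θ → V (k + 1) < 2 * θ) : Tendsto V atTop (𝓝 0) := by
  rw [Metric.tendsto_atTop]
  intro ε hε
  obtain ⟨c, hc, hd⟩ := hdrift (ε / 2) (half_pos hε)
  obtain ⟨K, hK⟩ := eventually_atTop.1 (hd.and (hjump (ε / 2) (half_pos hε)))
  obtain ⟨k₀, hk₀, hVk₀⟩ : ∃ k, K ≤ k ∧ V k < ε / 2 := by
    by_contra! hcon
    have h1 : ∀ k, K ≤ k → V k ≤ V K - c * (∑ s ∈ Finset.range k, γ s - ∑ s ∈ Finset.range K, γ s) := by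
      intro k hk
      induction k, hk using Nat.le_induction with
      | base => simp
      | succ k hk ih =>
        have := (hK k hk).1 (hcon k hk)
        rw [Finset.sum_range_succ]
        linarith
    obtain ⟨k, hk, hk'⟩ := ((hsum.eventually_gt_atTop
      (V K / c + ∑ s ∈ Finset.range K, γ s)).and (eventually_ge_atTop K)).exists
    have h2 := h1 k hk'
    have h3 := hV k
    have h4 : V K / c < ∑ s ∈ Finset.range k, γ s - ∑ s ∈ Finset.range K, γ s := by linarith
    rw [div_lt_iff₀ hc] at h4
    linarith
  refine ⟨k₀, fun k hk => ?_⟩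
  rw [dist_zero_right, Real.norm_of_nonneg (hV k)]
  induction k, hk using Nat.le_induction with
  | base => linarith
  | succ k hk ih =>
    rcases lt_or_ge (V k) (ε / 2) with h | h
    · have := (hK k (hk₀.trans hk)).2 h
      linarith
    · have := (hK k (hk₀.trans hk)).1 h
      have := mul_nonneg hc.le (hγ k)
      linarith

theorem le_sqrt_div {c t v : ℝ} (hc : 0 < c) (h : c * t ^ 2 ≤ v) : t ≤ √(v / c) :=
  Real.le_sqrt_of_sq_le (by rw [le_div_iff₀ hc]; linarith)

/-- A Lyapunov function `V`, comparable to `a ^ 2 + b ^ 2`, whose descent `G₁ + G₂` is at least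
linear in `a` and `b`, tends to zero if the perturbations are asymptotically small compared with
`1 + (a + b)`. -/
theorem tendsto_zero_of_perturbed_descent {V γ a b ε τ G₁ G₂ : ℕ → ℝ} (hV : ∀ k, 0 ≤ V k)
    (han : ∀ k, 0 ≤ a k) (hbn : ∀ k, 0 ≤ b k) (hεn : ∀ k, 0 ≤ ε k) (hγ0 : ∀ k, 0 ≤ γ k)
    (hγ : Tendsto (fun k => ∑ s ∈ Finset.range k, γ s) atTop atTop)
    (hγlim : Tendsto γ atTop (𝓝 0)) (hε0 : Tendsto ε atTop (𝓝 0)) (hτ : Tendsto τ atTop (𝓝 0))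
    (hτn : ∀ k, 0 ≤ τ k) (hVab : ∀ k, V k ≤ (a k + b k + τ k) ^ 2)
    {c₁ c₂ : ℝ} (hc₁ : 0 < c₁) (hc₂ : 0 < c₂)
    (haV : ∀ k, c₁ * a k ^ 2 ≤ V k) (hbV : ∀ k, c₂ * b k ^ 2 ≤ V k)
    (hG₁ : ∀ᶠ k in atTop, 0 ≤ G₁ k) (hG₂ : ∀ᶠ k in atTop, 0 ≤ G₂ k)
    (hdrift : ∀ᶠ k in atTop,
      V (k + 1) ≤ V k - 2 * γ k * (G₁ k + G₂ k - ε k * (1 + (a k + b k))))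
    (hgr₁ : ∀ δ > 0, ∃ d > 0, ∀ᶠ k in atTop, δ ≤ a k → d * a k ≤ G₁ k)
    (hgr₂ : ∀ δ > 0, ∃ d > 0, ∀ᶠ k in atTop, δ ≤ b k → d * b k ≤ G₂ k) :
    Tendsto V atTop (𝓝 0) := by
  refine tendsto_zero_of_drift hV hγ hγ0 ?_ ?_
  · intro θ hθ
    -- If `V k ≥ θ`, then `a + b + τ ≥ 4δ`; once `τ ≤ 2δ`, the larger of `a` and `b` is at least
    -- `δ`.
    set δ := √θ / 4 with hδ
    have hδ0 : 0 < δ := by positivity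
    have hθδ : θ = (4 * δ) ^ 2 := by
      rw [hδ, mul_div_cancel₀ _ four_ne_zero, Real.sq_sqrt hθ.le]
    obtain ⟨d₁, hd₁0, hgr₁⟩ := hgr₁ δ hδ0
    obtain ⟨d₂, hd₂0, hgr₂⟩ := hgr₂ δ hδ0
    set d := min d₁ d₂ with hd
    have hd0 : 0 < d := lt_min hd₁0 hd₂0
    refine ⟨d * δ, mul_pos hd0 hδ0, ?_⟩
    -- Since `1 ≤ (a + b) / (2δ)`, this threshold limits the perturbation to `d (a + b) / 4`, half
    -- of the guaranteed descent.
    have hε' : ∀ᶠ k in atTop, ε k < d / 4 / (1 / (2 * δ) + 1) :=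
      hε0.eventually (gt_mem_nhds (by positivity))
    filter_upwards [hdrift, hτ.eventually (ge_mem_nhds (by positivity : 0 < 2 * δ)), hε',
      hG₁, hG₂, hgr₁, hgr₂] with k hk hsp hεk hG1 hG2 hgr₁ hgr₂ hVk
    refine hk.trans ?_
    have han := han k
    have hbn := hbn k
    have hρ : 2 * δ ≤ a k + b k := by
      have h1 := hVk.trans (hVab k)
      rw [hθδ] at h1
      have h2 := le_of_sq_le_sq h1 (by linarith [hτn k])
      linarith
    have hG : d * ((a k + b k) / 2) ≤ G₁ k + G₂ k := by
      rcases le_total (b k) (a k) with h | h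
      · have h1 := hgr₁ (by linarith)
        have h2 : d * ((a k + b k) / 2) ≤ d₁ * a k :=
          mul_le_mul (min_le_left _ _) (by linarith) (by positivity) hd₁0.le
        linarith
      · have h1 := hgr₂ (by linarith)
        have h2 : d * ((a k + b k) / 2) ≤ d₂ * b k :=
          mul_le_mul (min_le_right _ _) (by linarith) (by positivity) hd₂0.le
        linarith
    have hεb : ε k * (1 + (a k + b k)) ≤ d / 4 * (a k + b k) := by
      rw [lt_div_iff₀ (by positivity)] at hεk
      have h1 : 1 ≤ 1 / (2 * δ) * (a k + b k) := by
        rw [one_div, ← div_eq_inv_mul, one_le_div (by positivity)]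
        exact hρ
      calc ε k * (1 + (a k + b k)) ≤ ε k * (1 / (2 * δ) * (a k + b k) + (a k + b k)) :=
            mul_le_mul_of_nonneg_left (by linarith) (hεn k)
        _ = ε k * (1 / (2 * δ) + 1) * (a k + b k) := by ring
        _ ≤ d / 4 * (a k + b k) := mul_le_mul_of_nonneg_right hεk.le (by positivity)
    have hfin : d * δ / 2 ≤ G₁ k + G₂ k - ε k * (1 + (a k + b k)) := by
      have := mul_le_mul_of_nonneg_left hρ hd0.le
      linarith
    have := mul_le_mul_of_nonneg_left hfin (mul_nonneg zero_le_two (hγ0 k))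
    linarith
  · intro θ hθ
    -- A bound on `a + b` on the sublevel set `V < θ`, so the perturbation there vanishes with `γ`
    -- and `ε`.
    set R := √(θ / c₁) + √(θ / c₂) with hR
    have hlim : Tendsto (fun k => 2 * γ k * (ε k * (1 + R))) atTop (𝓝 0) := by
      simpa using (hγlim.const_mul 2).mul (hε0.mul_const (1 + R))
    filter_upwards [hdrift, hlim.eventually (gt_mem_nhds hθ), hG₁, hG₂] with k hk hlt hG1 hG2 hVk
    have h1 : a k ≤ √(θ / c₁) := le_sqrt_div hc₁ ((haV k).trans hVk.le)
    have h2 : b k ≤ √(θ / c₂) := le_sqrt_div hc₂ ((hbV k).trans hVk.le)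
    have h3 : ε k * (1 + (a k + b k)) ≤ ε k * (1 + R) :=
      mul_le_mul_of_nonneg_left (by linarith) (hεn k)
    have h4 := mul_le_mul_of_nonneg_left
      (show -(ε k * (1 + R)) ≤ G₁ k + G₂ k - ε k * (1 + (a k + b k)) by linarith)
      (mul_nonneg zero_le_two (hγ0 k))
    linarith

/-! ### Convergence to the saddle point -/

section

variable {n₁ n₂ m₁ m₂ : ℕ}

theorem StepsizeCondition.tendsto_zero {γ : ℕ → ℝ} (h : StepsizeCondition γ) :
    Tendsto γ atTop (𝓝 0) := by
  have h1 := h.2.2.2.tendsto_atTop_zero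
  rw [tendsto_zero_iff_abs_tendsto_zero]
  have h2 := h1.sqrt
  simpa [Real.sqrt_sq_eq_abs, Function.comp_def] using h2

theorem StepsizeCondition.nonneg {γ : ℕ → ℝ} (h : StepsizeCondition γ) (k : ℕ) : 0 ≤ γ k :=
  h.2.1.le_of_tendsto h.tendsto_zero k

/-- Uniform weights give a positive multiple of the sum, which has the same saddle points. -/
theorem exists_isSaddlePoint_sumObjective (hn : 0 < n₁) {X : Set (Euc m₁)} {Y : Set (Euc m₂)}
    {f : Fin n₁ → Euc m₁ → Euc m₂ → ℝ} (h : SaddlePointsExist X Y f) :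
    ∃ xs ys, IsSaddlePoint X Y (sumObjective f) xs ys := by
  have hn' : (0 : ℝ) < n₁ := Nat.cast_pos.2 hn
  obtain ⟨xs, ys, h1, h2, h3, h4⟩ := h (fun _ => (n₁ : ℝ)⁻¹)
    ⟨fun _ => by positivity, by simp [hn'.ne']⟩
  simp only [← Finset.mul_sum] at h3 h4
  exact ⟨xs, ys, h1, h2, fun y hy => le_of_mul_le_mul_left (h3 y hy) (by positivity),
    fun x hx => le_of_mul_le_mul_left (h4 x hx) (by positivity)⟩

theorem convexOn_sumObjective {f : Fin n₁ → Euc m₁ → Euc m₂ → ℝ} (hf : ∀ i, ConvexConcave (f i))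
    (y : Euc m₂) : ConvexOn ℝ Set.univ fun x => sumObjective f x y := by
  refine ⟨convex_univ, fun u _ v _ a b ha hb hab => ?_⟩
  simp only [sumObjective, smul_eq_mul, Finset.mul_sum, ← Finset.sum_add_distrib]
  exact Finset.sum_le_sum fun i _ => ((hf i).1 y).2 (Set.mem_univ u) (Set.mem_univ v) ha hb hab

theorem concaveOn_sumObjective {f : Fin n₁ → Euc m₁ → Euc m₂ → ℝ} (hf : ∀ i, ConvexConcave (f i))
    (x : Euc m₁) : ConcaveOn ℝ Set.univ fun y => sumObjective f x y := by
  refine ⟨convex_univ, fun u _ v _ a b ha hb hab => ?_⟩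
  simp only [sumObjective, smul_eq_mul, Finset.mul_sum, ← Finset.sum_add_distrib]
  exact Finset.sum_le_sum fun i _ => ((hf i).2 x).2 (Set.mem_univ u) (Set.mem_univ v) ha hb hab

theorem neg_mem_concaveSubdiff {m : ℕ} {φ : Euc m → ℝ} {z q : Euc m}
    (h : q ∈ convexSubdiff (fun w => -φ w) z) : -q ∈ concaveSubdiff φ z := fun w => by
  have := h w
  rw [inner_neg_right]
  linarith

theorem neg_mem_convexSubdiff {m : ℕ} {φ : Euc m → ℝ} {z q : Euc m}
    (h : q ∈ concaveSubdiff φ z) : -q ∈ convexSubdiff (fun w => -φ w) z := fun w => by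
  have := h w
  rw [inner_neg_right]
  linarith

theorem abs_sum_sub_sum_le {n : ℕ} {a b : Fin n → ℝ} {L : ℝ} (h : ∀ i, |a i - b i| ≤ L) :
    |∑ i, a i - ∑ i, b i| ≤ n * L := by
  rw [← Finset.sum_sub_distrib]
  refine (Finset.abs_sum_le_sum_abs _ _).trans ((Finset.sum_le_sum fun i _ => h i).trans_eq ?_)
  simp

/-- The states of both subnetworks converge, provided that each subnetwork follows the subgradient
dynamics and its information on the other one is asymptotically correct. -/
theorem tendsto_saddlePoint {X : Set (Euc m₁)} {Y : Set (Euc m₂)} (hX : IsClosed X)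
    (hY : IsClosed Y) {f : Fin n₁ → Euc m₁ → Euc m₂ → ℝ} {g : Fin n₂ → Euc m₁ → Euc m₂ → ℝ}
    (hf : ∀ i, ConvexConcave (f i)) (hg : ∀ i, ConvexConcave (g i))
    (hfg : ∀ x ∈ X, ∀ y ∈ Y, sumObjective f x y = sumObjective g x y)
    (hU : StrictConvexConcaveOn X Y (sumObjective f)) {xs : Euc m₁} {ys : Euc m₂}
    (hs : IsSaddlePoint X Y (sumObjective f) xs ys)
    {A₁ : ℕ → Matrix (Fin n₁) (Fin n₁) ℝ} {A₂ : ℕ → Matrix (Fin n₂) (Fin n₂) ℝ} {η L : ℝ}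
    {φ₁ est₁ : ℕ → Fin n₁ → ℝ} {φ₂ est₂ : ℕ → Fin n₂ → ℝ} {γ : ℕ → ℝ}
    (hγ : Tendsto (fun k => ∑ s ∈ Finset.range k, γ s) atTop atTop)
    {x q₁ : ℕ → Fin n₁ → Euc m₁} {y q₂ : ℕ → Fin n₂ → Euc m₂}
    {xb : ℕ → Fin n₁ → Euc m₂} {yb : ℕ → Fin n₂ → Euc m₁}
    (D₁ : IsSubgradientDynamics X Y f A₁ η φ₁ est₁ γ L x xb q₁)
    (D₂ : IsSubgradientDynamics Y X (fun j y x => -g j x y) A₂ η φ₂ est₂ γ L y yb q₂)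
    (hxb : ∀ i j, Tendsto (fun k => xb k i - y k j) atTop (𝓝 0))
    (hyb : ∀ i j, Tendsto (fun k => yb k i - x k j) atTop (𝓝 0)) :
    (∀ i, Tendsto (fun k => x k i) atTop (𝓝 xs)) ∧
      (∀ i, Tendsto (fun k => y k i) atTop (𝓝 ys)) := by
  obtain ⟨hxs, hys, hsy, hsx⟩ := hs
  have hXY : ∀ x ∈ X, ∀ y ∈ Y, ∑ i, f i x y = ∑ i, g i x y := hfg
  -- In `y` only the subgradients of the `g i` are bounded, but `∑ f i = ∑ g i` on `X × Y` makes the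
  -- sum of the `f i` Lipschitz in `y` with constant `n₂ * L`.
  obtain ⟨C₁, hC₁, hfy⟩ := exists_lipschitz_linear_growth ⟨xs, hxs⟩ ⟨ys, hys⟩ D₂.convex_X
    (fun i x => (hf i).2 x) D₁.L_nonneg (L' := n₂ * L) (mul_nonneg (Nat.cast_nonneg _) D₁.L_nonneg)
    (fun i x hx x' hx' y hy => D₁.abs_sub_le i hx hx' hy) (fun x hx y hy y' hy' => by
      rw [hXY x hx y hy, hXY x hx y' hy', mul_assoc]
      refine abs_sum_sub_sum_le fun i => ?_
      have := D₂.abs_sub_le i hy hy' hx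
      rwa [neg_sub_neg, abs_sub_comm] at this)
  obtain ⟨C₂, hC₂, hgx⟩ := exists_lipschitz_linear_growth (f := fun j y x => -g j x y)
    ⟨ys, hys⟩ ⟨xs, hxs⟩ D₁.convex_X
    (fun i y => ((hg i).1 y).neg) D₂.L_nonneg (L' := n₁ * L)
    (mul_nonneg (Nat.cast_nonneg _) D₂.L_nonneg)
    (fun i y hy y' hy' x hx => D₂.abs_sub_le i hy hy' hx) (fun y hy x hx x' hx' => by
      simp only [Finset.sum_neg_distrib]
      rw [neg_sub_neg, abs_sub_comm, ← hXY x hx y hy, ← hXY x' hx' y hy, mul_assoc]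
      exact abs_sum_sub_sum_le fun i => D₁.abs_sub_le i hx hx' hy)
  set i₀ : Fin n₁ := ⟨0, D₁.card_pos⟩
  set j₀ : Fin n₂ := ⟨0, D₂.card_pos⟩
  have hxX : ∀ᶠ k in atTop, x k i₀ ∈ X :=
    (eventually_ge_atTop 1).mono fun k hk => D₁.mem_X hk i₀
  have hyY : ∀ᶠ k in atTop, y k j₀ ∈ Y :=
    (eventually_ge_atTop 1).mono fun k hk => D₂.mem_X hk j₀
  obtain ⟨ε₁, hε₁, hd₁⟩ := D₁.exists_drift hC₁ hfy hxs i₀ hyY fun i => hxb i j₀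
  obtain ⟨ε₂, hε₂, hd₂⟩ := D₂.exists_drift hC₂ hgx hys j₀ hxX fun i => hyb i i₀
  set V₁ : ℕ → ℝ := fun k => ∑ i, φ₁ k i * ‖x k i - xs‖ ^ 2 with hV₁
  set V₂ : ℕ → ℝ := fun k => ∑ i, φ₂ k i * ‖y k i - ys‖ ^ 2 with hV₂
  set a : ℕ → ℝ := fun k => ‖x k i₀ - xs‖ with ha
  set b : ℕ → ℝ := fun k => ‖y k j₀ - ys‖ with hb
  -- The last factor converts `1 + ‖x‖ + ‖y‖` into a multiple of `1 + a + b`, measured from the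
  -- saddle point.
  set ε : ℕ → ℝ := fun k => (|ε₁ k| + |ε₂ k|) * (1 + ‖xs‖ + ‖ys‖) with hε
  have hε0 : Tendsto ε atTop (𝓝 0) := by
    simpa using (hε₁.abs.add hε₂.abs).mul_const (1 + ‖xs‖ + ‖ys‖)
  have hεn : ∀ k, 0 ≤ ε k := fun k => by positivity
  set G₁ : Euc m₁ → ℝ := fun u => sumObjective f u ys - sumObjective f xs ys with hG₁
  set G₂ : Euc m₂ → ℝ := fun v => sumObjective f xs ys - sumObjective f xs v with hG₂
  have hγ0 := D₁.step_nonneg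
  have hV1n : ∀ k, 0 ≤ V₁ k := fun k =>
    Finset.sum_nonneg fun i _ => mul_nonneg (D₁.perron_nonneg k i) (by positivity)
  have hV2n : ∀ k, 0 ≤ V₂ k := fun k =>
    Finset.sum_nonneg fun i _ => mul_nonneg (D₂.perron_nonneg k i) (by positivity)
  have hG1n : ∀ u ∈ X, 0 ≤ G₁ u := fun u hu => sub_nonneg.2 (hsx u hu)
  have hG2n : ∀ v ∈ Y, 0 ≤ G₂ v := fun v hv => sub_nonneg.2 (hsy v hv)
  have hdrift : ∀ᶠ k in atTop, V₁ (k + 1) + V₂ (k + 1) ≤ V₁ k + V₂ k -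
      2 * γ k * (G₁ (x k i₀) + G₂ (y k j₀) - ε k * (1 + (a k + b k))) := by
    filter_upwards [hd₁, hd₂, hxX, hyY] with k h1 h2 hx hy
    refine (add_le_add h1 h2).trans ?_
    -- In the second subnetwork `U(x, y)` enters with the opposite sign and cancels, which leaves
    -- `U(x, ys) - U(xs, y) = G₁ + G₂`.
    have e1 : sumObjective (fun j y x => -g j x y) (y k j₀) (x k i₀) =
        -sumObjective f (x k i₀) (y k j₀) := by
      rw [hfg _ hx _ hy]; simp [sumObjective]
    have e2 : sumObjective (fun j y x => -g j x y) ys (x k i₀) = -sumObjective f (x k i₀) ys := by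
      rw [hfg _ hx _ hys]; simp [sumObjective]
    rw [e1, e2]
    have e3 : 1 + ‖x k i₀‖ + ‖y k j₀‖ ≤ (1 + ‖xs‖ + ‖ys‖) * (1 + (a k + b k)) := by
      have t1 := norm_sub_norm_le (x k i₀) xs
      have t2 := norm_sub_norm_le (y k j₀) ys
      have t3 : 0 ≤ (‖xs‖ + ‖ys‖) * (a k + b k) := by positivity
      simp only [ha, hb] at t3 ⊢
      linarith
    have e4 : (ε₁ k + ε₂ k) * (1 + ‖x k i₀‖ + ‖y k j₀‖) ≤ ε k * (1 + (a k + b k)) := by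
      rw [hε, mul_assoc]
      exact mul_le_mul (add_le_add (le_abs_self _) (le_abs_self _)) e3 (by positivity)
        (by positivity)
    have e5 := mul_le_mul_of_nonneg_left e4 (mul_nonneg zero_le_two (hγ0 k))
    simp only [hG₁, hG₂]
    linarith
  have hVab : ∀ k, V₁ k + V₂ k ≤ (a k + b k + (∑ i, ‖x k i - x k i₀‖ + ∑ i, ‖y k i - y k j₀‖)) ^ 2 := by
    intro k
    have h1 := D₁.sum_le_sq k i₀ xs
    have h2 := D₂.sum_le_sq k j₀ ys
    have h3 : 0 ≤ (‖x k i₀ - xs‖ + ∑ i, ‖x k i - x k i₀‖) *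
      (‖y k j₀ - ys‖ + ∑ i, ‖y k i - y k j₀‖) := by positivity
    refine (add_le_add h1 h2).trans ?_
    simp only [ha, hb]
    linarith
  have hspread : Tendsto (fun k => ∑ i, ‖x k i - x k i₀‖ + ∑ i, ‖y k i - y k j₀‖) atTop (𝓝 0) := by
    have h1 := tendsto_finsetSum Finset.univ fun i _ => (D₁.tendsto_sub i i₀).norm
    have h2 := tendsto_finsetSum Finset.univ fun i _ => (D₂.tendsto_sub i j₀).norm
    simpa using h1.add h2
  obtain ⟨c₁, hc₁, hφ₁⟩ := exists_perron_lower D₁.weights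
  obtain ⟨c₂, hc₂, hφ₂⟩ := exists_perron_lower D₂.weights
  have hxV : ∀ k i, c₁ * ‖x k i - xs‖ ^ 2 ≤ V₁ k + V₂ k := fun k i => by
    have h1 := Finset.single_le_sum (f := fun i => φ₁ k i * ‖x k i - xs‖ ^ 2)
      (fun i _ => mul_nonneg (D₁.perron_nonneg k i) (by positivity)) (Finset.mem_univ i)
    have h2 := mul_le_mul_of_nonneg_right (hφ₁ k _ (D₁.perron k) i) (sq_nonneg ‖x k i - xs‖)
    have h3 := hV2n k
    have h4 : φ₁ k i * ‖x k i - xs‖ ^ 2 ≤ V₁ k := h1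
    linarith
  have hyV : ∀ k i, c₂ * ‖y k i - ys‖ ^ 2 ≤ V₁ k + V₂ k := fun k i => by
    have h1 := Finset.single_le_sum (f := fun i => φ₂ k i * ‖y k i - ys‖ ^ 2)
      (fun i _ => mul_nonneg (D₂.perron_nonneg k i) (by positivity)) (Finset.mem_univ i)
    have h2 := mul_le_mul_of_nonneg_right (hφ₂ k _ (D₂.perron k) i) (sq_nonneg ‖y k i - ys‖)
    have h3 := hV1n k
    have h4 : φ₂ k i * ‖y k i - ys‖ ^ 2 ≤ V₂ k := h1
    linarith
  have hlim : Tendsto (fun k => V₁ k + V₂ k) atTop (𝓝 0) := by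
    refine tendsto_zero_of_perturbed_descent (fun k => add_nonneg (hV1n k) (hV2n k))
      (fun k => norm_nonneg _) (fun k => norm_nonneg _) hεn hγ0 hγ D₁.step_lim hε0 hspread
      (fun k => by positivity) hVab hc₁ hc₂ (fun k => hxV k i₀) (fun k => hyV k j₀)
      (hxX.mono fun k hx => hG1n _ hx) (hyY.mono fun k hy => hG2n _ hy) hdrift ?_ ?_
    · intro δ hδ
      obtain ⟨d, hd, hgr⟩ := (hU.1 ys hys).exists_linear_growth hX (convexOn_sumObjective hf ys)
        hxs hsx hδ
      exact ⟨d, hd, hxX.mono fun k hx => hgr _ hx⟩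
    · intro δ hδ
      obtain ⟨d, hd, hgr⟩ := (hU.2 xs hxs).neg.exists_linear_growth hY
        (concaveOn_sumObjective hf xs).neg hys (fun v hv => neg_le_neg (hsy v hv)) hδ
      refine ⟨d, hd, hyY.mono fun k hy h => (hgr _ hy h).trans_eq ?_⟩
      simp only [hG₂, Pi.neg_apply]
      ring
  have hconv : ∀ c : ℝ, Tendsto (fun k => √((V₁ k + V₂ k) / c)) atTop (𝓝 0) := fun c => by
    simpa using (hlim.div_const c).sqrt
  refine ⟨fun i => tendsto_iff_norm_sub_tendsto_zero.2 ?_,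
    fun i => tendsto_iff_norm_sub_tendsto_zero.2 ?_⟩
  · exact squeeze_zero (fun _ => norm_nonneg _) (fun k => le_sqrt_div hc₁ (hxV k i)) (hconv c₁)
  · exact squeeze_zero (fun _ => norm_nonneg _) (fun k => le_sqrt_div hc₂ (hyV k i)) (hconv c₂)

/-! ### From the network to the dynamics of the subnetworks. -/

theorem WeightRule.consensusWeights {N : Network n₁ n₂} (h : WeightRule N) (hc : Connectivity N) :
    ∃ η, ConsensusWeights N.A₁ η ∧ ConsensusWeights N.A₂ η := by
  obtain ⟨⟨η, hη, -, h1, h2, -, -⟩, h3, h4, -, -⟩ := h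
  refine ⟨η, ⟨hη, N.A₁_nonneg, fun k i => ?_, N.A₁_loop, fun k i j hj => h1 k i j (by
    simpa [neighbors] using hj), hc.2.1⟩, ⟨hη, N.A₂_nonneg, fun k i => ?_, N.A₂_loop,
    fun k i j hj => h2 k i j (by simpa [neighbors] using hj), hc.2.2⟩⟩
  · rw [← h3 k i]
    simpa using (sum_neighbors_eq (N.A₁_nonneg k) (fun _ => (1 : ℝ)) i).symm
  · rw [← h4 k i]
    simpa using (sum_neighbors_eq (N.A₂_nonneg k) (fun _ => (1 : ℝ)) i).symm

/-- The network achieves a Nash equilibrium with any estimates that learn the Perron entries. -/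
theorem achievesNash_of_learnsPerron (hn₁ : 0 < n₁) (hn₂ : 0 < n₂)
    {X : Set (Euc m₁)} {Y : Set (Euc m₂)}
    (hXclosed : IsClosed X) (hXconvex : Convex ℝ X)
    (hYclosed : IsClosed Y) (hYconvex : Convex ℝ Y)
    {f : Fin n₁ → Euc m₁ → Euc m₂ → ℝ} {g : Fin n₂ → Euc m₁ → Euc m₂ → ℝ}
    (hf : ∀ i, ConvexConcave (f i)) (hg : ∀ i, ConvexConcave (g i))
    (hfg : ∀ x ∈ X, ∀ y ∈ Y, sumObjective f x y = sumObjective g x y)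
    (hU : StrictConvexConcaveOn X Y (sumObjective f))
    {N : Network n₁ n₂} (hA1 : SaddlePointsExist X Y f) (hA2 : Connectivity N)
    (hA3 : WeightRule N) (hA4 : SubgradientsBounded X Y f g)
    {γ : ℕ → ℝ} (hγ : StepsizeCondition γ) {est₁ : Estimator n₁} {est₂ : Estimator n₂}
    (h₁ : LearnsPerron N.A₁ est₁) (h₂ : LearnsPerron N.A₂ est₂) :
    AchievesNash X Y f g N (learnedStepsize N.A₁ est₁ γ) (learnedStepsize N.A₂ est₂ γ) := by
  rintro x y ⟨xb, yb, q₁, q₂, hxb, hyb, hq₁, hq₂, hpx, hpy⟩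
  obtain ⟨η, hW₁, hW₂⟩ := hA3.consensusWeights hA2
  obtain ⟨hpos₁, φ₁, hφ₁, hest₁⟩ := h₁
  obtain ⟨hpos₂, φ₂, hφ₂, hest₂⟩ := h₂
  obtain ⟨L, hL, hbd⟩ := hA4
  obtain ⟨xs, ys, hs⟩ := exists_isSaddlePoint_sumObjective hn₁ hA1
  obtain ⟨⟨T, -, hT⟩, -, -⟩ := hA2
  obtain ⟨-, -, -, hB₁, hB₂⟩ := hA3
  have hT₁ : ∃ T : ℕ, ∀ k i, ∃ s, k ≤ s ∧ s < k + T ∧ (neighbors (N.B₁ s) i).Nonempty :=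
    ⟨T, fun k => (hT k).1⟩
  have hT₂ : ∃ T : ℕ, ∀ k i, ∃ s, k ≤ s ∧ s < k + T ∧ (neighbors (N.B₂ s) i).Nonempty :=
    ⟨T, fun k => (hT k).2⟩
  have hav₁ : ∀ k i, neighborAverage (N.A₁ k) (x k) i = ∑ j, N.A₁ k i j • x k j := fun k i =>
    sum_neighbors_eq (N.A₁_nonneg k) (x k) i
  have hav₂ : ∀ k i, neighborAverage (N.A₂ k) (y k) i = ∑ j, N.A₂ k i j • y k j := fun k i =>
    sum_neighbors_eq (N.A₂_nonneg k) (y k) i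
  simp only [hav₁, hav₂, learnedStepsize] at hq₁ hq₂ hpx hpy
  have D₁ : IsSubgradientDynamics X Y f N.A₁ η φ₁ (est₁ N.A₁) γ L x xb q₁ :=
    { card_pos := hn₁
      weights := hW₁
      convex_X := hXconvex
      convex_f := fun i => (hf i).1
      perron := hφ₁
      est_pos := hpos₁
      est_lim := hest₁
      step_nonneg := hγ.nonneg
      step_lim := hγ.tendsto_zero
      L_nonneg := hL.le
      bound := fun i x hx y hy => (hbd x hx y hy).1 i
      mem_Y := eventually_received_mem N.B₁_nonneg hB₁ hT₁ hxb hYconvex fun k i => (hpy k i).1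
      subgrad := hq₁
      proj := hpx }
  -- Ascent on the concave `g` is descent on the convex `-g`, with the two constraint sets
  -- exchanged.
  have D₂ : IsSubgradientDynamics Y X (fun j y x => -g j x y) N.A₂ η φ₂ (est₂ N.A₂) γ L y yb
      (fun k i => -q₂ k i) :=
    { card_pos := hn₂
      weights := hW₂
      convex_X := hYconvex
      convex_f := fun i x => ((hg i).2 x).neg
      perron := hφ₂
      est_pos := hpos₂
      est_lim := hest₂
      step_nonneg := hγ.nonneg
      step_lim := hγ.tendsto_zero
      L_nonneg := hL.le
      bound := fun i y hy x hx q hq => by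
        simpa using (hbd x hx y hy).2 i (-q) (neg_mem_concaveSubdiff hq)
      mem_Y := eventually_received_mem N.B₂_nonneg hB₂ hT₂ hyb hXconvex fun k i => (hpx k i).1
      subgrad := fun k i => neg_mem_convexSubdiff (hq₂ k i)
      proj := fun k i => by simpa only [smul_neg, sub_neg_eq_add] using hpy k i }
  exact ⟨xs, ys, hs, tendsto_saddlePoint hXclosed hYclosed hf hg hfg hU hs hγ.2.2.1 D₁ D₂
    (tendsto_received_sub N.B₁_nonneg hB₁ hT₁ hxb D₂.tendsto_add_sub)
    (tendsto_received_sub N.B₂_nonneg hB₂ hT₂ hyb D₁.tendsto_add_sub)⟩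

end

end

theorem theorem5 {n₁ n₂ m₁ m₂ : ℕ} (hn₁ : 0 < n₁) (hn₂ : 0 < n₂)
    (X : Set (Euc m₁)) (Y : Set (Euc m₂))
    (hXclosed : IsClosed X) (hXconvex : Convex ℝ X)
    (hYclosed : IsClosed Y) (hYconvex : Convex ℝ Y)
    (f : Fin n₁ → Euc m₁ → Euc m₂ → ℝ) (g : Fin n₂ → Euc m₁ → Euc m₂ → ℝ)
    (hf : ∀ i, ConvexConcave (f i)) (hg : ∀ i, ConvexConcave (g i))
    (hfg : ∀ x ∈ X, ∀ y ∈ Y, sumObjective f x y = sumObjective g x y)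
    (hU : StrictConvexConcaveOn X Y (sumObjective f))
    (N : Network n₁ n₂)
    (hA1 : SaddlePointsExist X Y f)
    (hA2 : Connectivity N)
    (hA3 : WeightRule N)
    (hA4 : SubgradientsBounded X Y f g)
    (γ : ℕ → ℝ) (hγ : StepsizeCondition γ) :
    -- the estimators below are distributed rules
    (IsDistributed (consensusEstimator n₁) ∧ IsDistributed (consensusEstimator n₂) ∧
      ∀ p, IsDistributed (periodicEstimator n₁ p) ∧ IsDistributed (periodicEstimator n₂ p)) ∧
    -- case (i)
    (HasCommonLeftEigenvector N.A₁ → HasCommonLeftEigenvector N.A₂ →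
      LearnsPerron N.A₁ (consensusEstimator n₁) ∧ LearnsPerron N.A₂ (consensusEstimator n₂) ∧
      AchievesNash X Y f g N (learnedStepsize N.A₁ (consensusEstimator n₁) γ)
        (learnedStepsize N.A₂ (consensusEstimator n₂) γ)) ∧
    -- case (ii)
    (∀ p₁ p₂, SwitchesPeriodically N.A₁ p₁ → SwitchesPeriodically N.A₂ p₂ →
      LearnsPerron N.A₁ (periodicEstimator n₁ p₁) ∧ LearnsPerron N.A₂ (periodicEstimator n₂ p₂) ∧
      AchievesNash X Y f g N (learnedStepsize N.A₁ (periodicEstimator n₁ p₁) γ)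
        (learnedStepsize N.A₂ (periodicEstimator n₂ p₂) γ)) ∧
    -- in both cases, any other distributed estimators that learn the Perron entries also work
    ((HasCommonLeftEigenvector N.A₁ ∧ HasCommonLeftEigenvector N.A₂) ∨
        (∃ p₁ p₂, SwitchesPeriodically N.A₁ p₁ ∧ SwitchesPeriodically N.A₂ p₂) →
      ∀ (est₁ : Estimator n₁) (est₂ : Estimator n₂),
        IsDistributed est₁ → IsDistributed est₂ →
        LearnsPerron N.A₁ est₁ → LearnsPerron N.A₂ est₂ →
        AchievesNash X Y f g N (learnedStepsize N.A₁ est₁ γ) (learnedStepsize N.A₂ est₂ γ)) := by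
  have key : ∀ (est₁ : Estimator n₁) (est₂ : Estimator n₂), LearnsPerron N.A₁ est₁ →
      LearnsPerron N.A₂ est₂ →
      AchievesNash X Y f g N (learnedStepsize N.A₁ est₁ γ) (learnedStepsize N.A₂ est₂ γ) :=
    fun est₁ est₂ h₁ h₂ => achievesNash_of_learnsPerron hn₁ hn₂ hXclosed hXconvex hYclosed hYconvex
      hf hg hfg hU hA1 hA2 hA3 hA4 hγ h₁ h₂
  obtain ⟨η, hW₁, hW₂⟩ := hA3.consensusWeights hA2
  refine ⟨⟨isDistributed_consensusEstimator n₁, isDistributed_consensusEstimator n₂, fun p =>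
    ⟨isDistributed_periodicEstimator n₁ p, isDistributed_periodicEstimator n₂ p⟩⟩, ?_, ?_, ?_⟩
  · intro h₁ h₂
    have l₁ := learnsPerron_consensusEstimator hW₁ h₁
    have l₂ := learnsPerron_consensusEstimator hW₂ h₂
    exact ⟨l₁, l₂, key _ _ l₁ l₂⟩
  · intro p₁ p₂ h₁ h₂
    have l₁ := learnsPerron_periodicEstimator hW₁ h₁
    have l₂ := learnsPerron_periodicEstimator hW₂ h₂
    exact ⟨l₁, l₂, key _ _ l₁ l₂⟩
  · exact fun _ est₁ est₂ _ _ h₁ h₂ => key est₁ est₂ h₁ h₂
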